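/- Let $d\in\{2,3\}$, let $D\subset\mathbb{R}^d$ be a bounded simply connected open set with boundary of class $C^2$, let $n_y$ be the unit outward normal of $D$ at $y\in\partial D$, $\sigma$ the surface measure on $\partial D$, and $E=\mathbb{R}^d\setminus\overline{D}$. Let $G(x,y)=-\frac{1}{2\pi}\log|x-y|$ if $d=2$ and $G(x,y)=\frac{1}{4\pi|x-y|}$ if $d=3$. Let $\mu$ be a real continuous function on $\partial D$ and let $u$ be represented in $E$ as the single-layer potential with density $\mu$, $$u(z)=\int_{\partial D}G(z,y)\,\mu(y)\,d\sigma_y,\qquad z\in E$$ (this is the representation of the solution of the exterior Neumann problem $\Delta u=0$ in $E$, $\partial_n u=g$ on $\partial D$). Let $x=x^*+\ell\, n_{x^*}\in E$ with $x^*\in\partial D$ and $\ell\in\mathbb{R}$, and let $u_{\rm sol}\in C^2(D)\cap C^1(\overline{D})$ be harmonic in $D$ with $\partial_n u_{\rm sol}(x^*)=1$. Then $$\begin{aligned}u(x)&=\int_{\partial D}G(x,y)\,\mu(y)\,[1-\partial_{n}u_{\rm sol}(y)]\,d\sigma_y+\int_{\partial D}G(x,y)\,[\mu(y)-\mu(x^*)]\,\partial_{n}u_{\rm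 sol}(y)\,d\sigma_y\\&\quad+\mu(x^*)\int_{\partial D}\partial_{n_y}G(x,y)\,[u_{\rm sol}(y)-u_{\rm sol}(x^*)]\,d\sigma_y,\end{aligned}$$ where all the integrals (including the one defining $u(x)$) converge absolutely, and each of the three integrands vanishes at $y=x^*$. -/

import Mathlib

open MeasureTheory
open scoped Gradient

noncomputable section

/-- `φ` is a defining function of class `C²` of the set `D` near the point `p`: on the open
neighbourhood `U` of the boundary point `p` the set `D` is `{φ < 0}`, and `φ(p) = 0`,
`∇φ(p) ≠ 0`. -/
structure IsLocalDefiningFunction {d : ℕ} (D : Set (EuclideanSpace ℝ (Fin d)))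
    (p : EuclideanSpace ℝ (Fin d)) (U : Set (EuclideanSpace ℝ (Fin d)))
    (φ : EuclideanSpace ℝ (Fin d) → ℝ) : Prop where
  isOpen : IsOpen U
  mem : p ∈ U
  contDiffOn : ContDiffOn ℝ 2 φ U
  mem_iff : ∀ y ∈ U, (y ∈ D ↔ φ y < 0)
  eq_zero : φ p = 0
  gradient_ne_zero : ∇ φ p ≠ 0

/-- A bounded simply connected open subset of `ℝᵈ` whose boundary is of class `C²`. -/
structure IsC2Domain {d : ℕ} (D : Set (EuclideanSpace ℝ (Fin d))) : Prop where
  isOpen : IsOpen D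
  isBounded : Bornology.IsBounded D
  isSimplyConnected : IsSimplyConnected D
  exists_defining : ∀ p ∈ frontier D, ∃ U φ, IsLocalDefiningFunction D p U φ

/-- `n` is the unit outward normal of `D` at the boundary point `p`: it is the normalized gradient
of a local defining function of `D` (negative inside `D`). -/
def IsUnitOutwardNormal {d : ℕ} (D : Set (EuclideanSpace ℝ (Fin d)))
    (p n : EuclideanSpace ℝ (Fin d)) : Prop :=
  ∃ U φ, IsLocalDefiningFunction D p U φ ∧ n = ‖∇ φ p‖⁻¹ • ∇ φ p

/-- The unit outward normal at a point is unique. -/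
theorem IsUnitOutwardNormal.unique {d : ℕ} {D : Set (EuclideanSpace ℝ (Fin d))}
    {p n m : EuclideanSpace ℝ (Fin d)} (hn : IsUnitOutwardNormal D p n)
    (hm : IsUnitOutwardNormal D p m) : n = m := by
  have key : ∀ (U : Set (EuclideanSpace ℝ (Fin d))) (φ : EuclideanSpace ℝ (Fin d) → ℝ),
      IsLocalDefiningFunction D p U φ → ∀ w : EuclideanSpace ℝ (Fin d),
      HasDerivAt (fun t : ℝ => φ (p + t • w)) (inner ℝ (∇ φ p) w) 0 ∧
      ∀ᶠ t in nhdsWithin (0 : ℝ) (Set.Ioi 0), (p + t • w ∈ D ↔ φ (p + t • w) < 0) := by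
    intro U φ h w
    have hline : HasDerivAt (fun t : ℝ => p + t • w) w 0 := by
      simpa using ((hasDerivAt_id (0 : ℝ)).smul_const w).const_add p
    have hU : U ∈ nhds p := h.isOpen.mem_nhds h.mem
    refine ⟨?_, ?_⟩
    · have hd : DifferentiableAt ℝ φ p :=
        (h.contDiffOn.contDiffAt hU).differentiableAt (by norm_num)
      have hg := hd.hasGradientAt.hasFDerivAt
      have h0 : p = p + (0 : ℝ) • w := by simp
      rw [h0] at hg
      have := hg.comp_hasDerivAt (0 : ℝ) hline
      simpa [Function.comp_def] using this
    · have hc : Filter.Tendsto (fun t : ℝ => p + t • w) (nhds 0) (nhds p) := by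
        simpa using hline.continuousAt.tendsto
      filter_upwards [nhdsWithin_le_nhds (hc hU)] with t ht using h.mem_iff _ ht
  obtain ⟨U, φ, hφ, rfl⟩ := hn
  obtain ⟨V, ψ, hψ, rfl⟩ := hm
  set a := ∇ φ p with ha
  set b := ∇ ψ p with hb
  have ha0 : 0 < ‖a‖ := norm_pos_iff.2 hφ.gradient_ne_zero
  have hb0 : 0 < ‖b‖ := norm_pos_iff.2 hψ.gradient_ne_zero
  by_contra hne
  set n := ‖a‖⁻¹ • a with hn
  set m := ‖b‖⁻¹ • b with hm
  have hn1 : ‖n‖ = 1 := by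
    rw [hn, norm_smul, norm_inv, norm_norm, inv_mul_cancel₀ ha0.ne']
  have hm1 : ‖m‖ = 1 := by
    rw [hm, norm_smul, norm_inv, norm_norm, inv_mul_cancel₀ hb0.ne']
  have hlt : inner ℝ n m < 1 := (inner_lt_one_iff_real_of_norm_eq_one hn1 hm1).2 hne
  have han : a = ‖a‖ • n := by rw [hn, smul_smul, mul_inv_cancel₀ ha0.ne', one_smul]
  have hbm : b = ‖b‖ • m := by rw [hm, smul_smul, mul_inv_cancel₀ hb0.ne', one_smul]
  have h1 : inner ℝ a (m - n) < 0 := by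
    rw [han, real_inner_smul_left, inner_sub_right, real_inner_self_eq_norm_sq, hn1]
    nlinarith
  have h2 : 0 < inner ℝ b (m - n) := by
    rw [hbm, real_inner_smul_left, inner_sub_right, real_inner_self_eq_norm_sq, hm1,
      real_inner_comm]
    nlinarith
  obtain ⟨d1, e1⟩ := key U φ hφ (m - n)
  obtain ⟨d2, e2⟩ := key V ψ hψ (m - n)
  have f1 : ∀ᶠ t in nhdsWithin (0 : ℝ) (Set.Ioi 0), φ (p + t • (m - n)) < 0 := by
    have := (hasDerivAt_iff_tendsto_slope.1 d1).eventually (gt_mem_nhds h1)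
    filter_upwards [nhdsWithin_mono 0 (fun t ht => ne_of_gt ht) this, self_mem_nhdsWithin]
      with t ht htpos
    have htpos : 0 < t := htpos
    simp only [slope_def_field, zero_smul, add_zero, hφ.eq_zero, sub_zero] at ht
    by_contra hc
    exact absurd ht (not_lt.2 (div_nonneg (not_lt.1 hc) htpos.le))
  have f2 : ∀ᶠ t in nhdsWithin (0 : ℝ) (Set.Ioi 0), 0 < ψ (p + t • (m - n)) := by
    have := (hasDerivAt_iff_tendsto_slope.1 d2).eventually (lt_mem_nhds h2)
    filter_upwards [nhdsWithin_mono 0 (fun t ht => ne_of_gt ht) this, self_mem_nhdsWithin]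
      with t ht htpos
    have htpos : 0 < t := htpos
    simp only [slope_def_field, zero_smul, add_zero, hψ.eq_zero, sub_zero] at ht
    by_contra hc
    exact absurd ht (not_lt.2 (div_nonpos_of_nonpos_of_nonneg (not_lt.1 hc) htpos.le))
  obtain ⟨t, ht1, ht2, ht3, ht4⟩ := (e1.and (e2.and (f1.and f2))).exists
  exact absurd (ht2.1 (ht1.2 ht3)) (not_lt.2 ht4.le)

open Classical in
/-- The unit outward normal `n_p` of `D` at `p` (and `0` where there is none). -/
def outwardNormal {d : ℕ} (D : Set (EuclideanSpace ℝ (Fin d)))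
    (p : EuclideanSpace ℝ (Fin d)) : EuclideanSpace ℝ (Fin d) :=
  if h : ∃ n, IsUnitOutwardNormal D p n then h.choose else 0

/-- The surface measure `σ` of the boundary of `D`: the `(d - 1)`-dimensional Hausdorff measure,
normalized so as to agree with Lebesgue measure on hyperplanes, restricted to `∂D`. -/
def surfaceMeasure {d : ℕ} (D : Set (EuclideanSpace ℝ (Fin d))) :
    Measure (EuclideanSpace ℝ (Fin d)) :=
  (Measure.euclideanHausdorffMeasure (d - 1)).restrict (frontier D)

/-- The normal derivative `∂ₙ v (y) = Dv(y) n_y` at a boundary point `y` of `D`, for `v` of class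
`C¹` on the closure of `D`. -/
def normalDeriv {d : ℕ} (D : Set (EuclideanSpace ℝ (Fin d)))
    (v : EuclideanSpace ℝ (Fin d) → ℝ) (y : EuclideanSpace ℝ (Fin d)) : ℝ :=
  fderivWithin ℝ v (closure D) y (outwardNormal D y)

/-- The fundamental solution of Laplace's equation in dimension `2` and in dimension `3`. -/
def laplaceKernel {d : ℕ} (x y : EuclideanSpace ℝ (Fin d)) : ℝ :=
  if d = 2 then -(1 / (2 * Real.pi)) * Real.log ‖x - y‖
  else 1 / (4 * Real.pi) * (1 / ‖x - y‖)

/-- The single-layer potential `∫_{∂D} G(x,y) μ(y) dσ_y`. -/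
def singleLayerPotential {d : ℕ} (D : Set (EuclideanSpace ℝ (Fin d)))
    (μ : EuclideanSpace ℝ (Fin d) → ℝ) (x : EuclideanSpace ℝ (Fin d)) : ℝ :=
  ∫ y, laplaceKernel x y * μ y ∂(surfaceMeasure D)

/-- `G(x,y) μ(y) [1 - ∂ₙv(y)]` -/
def integrandOne {d : ℕ} (D : Set (EuclideanSpace ℝ (Fin d)))
    (μ v : EuclideanSpace ℝ (Fin d) → ℝ) (x y : EuclideanSpace ℝ (Fin d)) : ℝ :=
  laplaceKernel x y * μ y * (1 - normalDeriv D v y)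

/-- `G(x,y) [μ(y) - μ(x*)] ∂ₙv(y)` -/
def integrandTwo {d : ℕ} (D : Set (EuclideanSpace ℝ (Fin d)))
    (μ v : EuclideanSpace ℝ (Fin d) → ℝ) (xs x y : EuclideanSpace ℝ (Fin d)) : ℝ :=
  laplaceKernel x y * (μ y - μ xs) * normalDeriv D v y

/-- `∂_{n_y} G(x,y) [v(y) - v(x*)]`, the normal derivative being taken in `y` -/
def integrandThree {d : ℕ} (D : Set (EuclideanSpace ℝ (Fin d)))
    (v : EuclideanSpace ℝ (Fin d) → ℝ) (xs x y : EuclideanSpace ℝ (Fin d)) : ℝ :=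
  normalDeriv D (fun z => laplaceKernel x z) y * (v y - v xs)

end

/-! Write `v` for the interior solution. Splitting `μ = μ(1 - ∂ₙv) + (μ - μ(x*))∂ₙv + μ(x*)∂ₙv`
under the integral gives the first two terms and `μ(x*) ∫ G ∂ₙv`. Since `x` lies outside the closure
of `D`, `G(x,·)` is harmonic in `D` and `C¹` up to the boundary, and Green's second identity
(`integral_green`) turns `∫ G ∂ₙv` into `∫ ∂ₙG (v - v(x*))`; the constant `v(x*)` may be subtracted
because only derivatives of `v` enter harmonicity. All integrands are continuous on the compact
boundary, whose surface measure is finite.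

Green's identity is the divergence theorem (`integral_inner_outwardNormal_eq_zero`) for `G∇v - (v -
c)∇G`, a divergence free field that is `C¹` in `D` but merely continuous up to the boundary. The
divergence theorem is proved directly for Hausdorff measure, by an ε-argument. Near a boundary point
with normal `e`, `D` is ε-close to a half space in the sense of `FlatChart`. In such a chart: (a)
the indicator of `D` is monotone under translations in a cone around `e`, so its tangential
derivatives are of order ε (`abs_integral_fderiv_le`); (b) slicing along lines parallel to `e`,
together with Lipschitz bounds for the projection of the boundary to the hyperplane, identifies the
flux in direction `e` with the surface integral up to a factor close to 1
(`integral_fderiv_le_and_le`); (c) the normal differs from `e` by at most ε. An inward shift reduces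
fields continuous up to the boundary to `C¹` fields. Each error is a small constant times the
surface integral of the cutoff function, so over a partition of unity the errors add up to that
constant times the total surface measure, however many charts are needed (`abs_flux_le`). Then ε
tends to 0. -/

/-! ### Flat charts: elementary geometry of a boundary close to a hyperplane. -/

/-- On the ball `ball p r` the set `D` is the sublevel set `{φ < 0}` of a function which differs
from the linear function `⟪e, ·⟫`, `‖e‖ = 1`, by a function with Lipschitz constant `ε ≤ 1/2`. -/
structure FlatChart {E : Type*} [NormedAddCommGroup E] [InnerProductSpace ℝ E] (D : Set E)
    (p e : E) (r ε : ℝ) (φ : E → ℝ) : Prop where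
  norm_eq : ‖e‖ = 1
  radius_pos : 0 < r
  pos : 0 < ε
  le_half : ε ≤ 1 / 2
  mem_iff : ∀ y ∈ Metric.ball p r, (y ∈ D ↔ φ y < 0)
  abs_sub_le : ∀ y ∈ Metric.ball p r, ∀ z ∈ Metric.ball p r,
    |φ y - φ z - inner ℝ e (y - z)| ≤ ε * ‖y - z‖

namespace FlatChart

open Metric Set Filter Topology

variable {E : Type*} [NormedAddCommGroup E] [InnerProductSpace ℝ E] {D : Set E} {p e : E}
  {r ε : ℝ} {φ : E → ℝ}

theorem continuousOn (h : FlatChart D p e r ε φ) : ContinuousOn φ (ball p r) := by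
  have : LipschitzOnWith (Real.toNNReal (1 + ε)) φ (ball p r) := by
    refine LipschitzOnWith.of_dist_le_mul fun y hy z hz => ?_
    rw [Real.dist_eq, dist_eq_norm, Real.coe_toNNReal _ (by linarith [h.pos])]
    have h1 := abs_le.1 (h.abs_sub_le y hy z hz)
    have h2 := abs_le.1 (abs_real_inner_le_norm e (y - z))
    rw [h.norm_eq, one_mul] at h2
    exact abs_le.2 ⟨by linarith, by linarith⟩
  exact this.continuousOn

theorem nonpos_of_mem_closure (h : FlatChart D p e r ε φ) {y : E} (hy : y ∈ ball p r)
    (hyD : y ∈ closure D) : φ y ≤ 0 := by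
  have hmem : ball p r ∈ 𝓝 y := isOpen_ball.mem_nhds hy
  have hc : Tendsto φ (𝓝[D ∩ ball p r] y) (𝓝 (φ y)) :=
    ((h.continuousOn.continuousAt hmem).tendsto).mono_left nhdsWithin_le_nhds
  have hne : (𝓝[D ∩ ball p r] y).NeBot := by
    rw [nhdsWithin_inter_of_mem' (mem_nhdsWithin_of_mem_nhds hmem)]
    exact mem_closure_iff_nhdsWithin_neBot.1 hyD
  refine le_of_tendsto hc ?_
  filter_upwards [self_mem_nhdsWithin] with z hz
  exact ((h.mem_iff z hz.2).1 hz.1).le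

theorem eq_zero_of_mem_frontier (h : FlatChart D p e r ε φ) (hD : IsOpen D) {y : E}
    (hy : y ∈ ball p r) (hyD : y ∈ frontier D) : φ y = 0 := by
  refine le_antisymm (h.nonpos_of_mem_closure hy (frontier_subset_closure hyD)) ?_
  by_contra hlt
  have : y ∈ D := (h.mem_iff y hy).2 (not_le.1 hlt)
  rw [hD.frontier_eq] at hyD
  exact hyD.2 this

/-- The function `φ` increases in directions close to `e`. -/
theorem le_add_of_inner (h : FlatChart D p e r ε φ) {w y : E} (hw : ε * ‖w‖ ≤ inner ℝ e w)
    (hy : y ∈ ball p r) {s : ℝ} (hs : 0 ≤ s) (hz : y - s • w ∈ ball p r) :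
    φ (y - s • w) ≤ φ y := by
  have h1 := (abs_le.1 (h.abs_sub_le y hy _ hz)).1
  rw [sub_sub_cancel, inner_smul_right, norm_smul, Real.norm_of_nonneg hs] at h1
  nlinarith

theorem lt_of_inner (h : FlatChart D p e r ε φ) {y : E}
    (hy : y ∈ ball p r) {s : ℝ} (hs : 0 < s) (hz : y - s • e ∈ ball p r) :
    φ (y - s • e) < φ y := by
  have h1 := (abs_le.1 (h.abs_sub_le y hy _ hz)).1
  rw [sub_sub_cancel, inner_smul_right, norm_smul, Real.norm_of_nonneg hs.le,
    real_inner_self_eq_norm_sq, h.norm_eq] at h1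
  nlinarith [h.le_half]

theorem sub_smul_mem (h : FlatChart D p e r ε φ) {y : E} (hy : y ∈ ball p r)
    (hyD : y ∈ closure D) {s : ℝ} (hs : 0 < s) (hz : y - s • e ∈ ball p r) : y - s • e ∈ D :=
  (h.mem_iff _ hz).2 ((h.lt_of_inner hy hs hz).trans_le (h.nonpos_of_mem_closure hy hyD))

/-- The boundary is a Lipschitz graph over the hyperplane orthogonal to `e`. -/
theorem norm_sub_le (h : FlatChart D p e r ε φ) (hD : IsOpen D) {y z : E}
    (hy : y ∈ ball p r) (hyD : y ∈ frontier D) (hz : z ∈ ball p r) (hzD : z ∈ frontier D) :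
    (1 - ε) * ‖y - z‖ ≤ ‖(y - z) - inner ℝ e (y - z) • e‖ := by
  have h1 := h.abs_sub_le y hy z hz
  rw [h.eq_zero_of_mem_frontier hD hy hyD, h.eq_zero_of_mem_frontier hD hz hzD, sub_zero,
    zero_sub, abs_neg] at h1
  have h2 := norm_sub_norm_le (y - z) (inner ℝ e (y - z) • e)
  rw [norm_smul, h.norm_eq, mul_one, Real.norm_eq_abs] at h2
  linarith

end FlatChart

/-! ### Normal field, flat charts and unique differentiability for a `C²` domain. -/

theorem IsUnitOutwardNormal.outwardNormal_eq {d : ℕ} {D : Set (EuclideanSpace ℝ (Fin d))}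
    {p n : EuclideanSpace ℝ (Fin d)} (hn : IsUnitOutwardNormal D p n) :
    outwardNormal D p = n := by
  have h : ∃ n, IsUnitOutwardNormal D p n := ⟨n, hn⟩
  rw [outwardNormal, dif_pos h]
  exact h.choose_spec.unique hn

namespace IsC2Domain

open Metric Set Filter Topology

variable {d : ℕ} {D : Set (EuclideanSpace ℝ (Fin d))}

theorem isCompact_closure (hD : IsC2Domain D) : IsCompact (closure D) :=
  hD.isBounded.isCompact_closure

theorem isCompact_frontier (hD : IsC2Domain D) : IsCompact (frontier D) :=
  hD.isCompact_closure.of_isClosed_subset isClosed_frontier frontier_subset_closure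

theorem norm_outwardNormal (hD : IsC2Domain D) {p : EuclideanSpace ℝ (Fin d)}
    (hp : p ∈ frontier D) : ‖outwardNormal D p‖ = 1 := by
  obtain ⟨U, φ, hφ⟩ := hD.exists_defining p hp
  rw [IsUnitOutwardNormal.outwardNormal_eq ⟨U, φ, hφ, rfl⟩, norm_smul, norm_inv, norm_norm,
    inv_mul_cancel₀ (norm_ne_zero_iff.2 hφ.gradient_ne_zero)]

/-- A defining function at `p` is also one at every boundary point near `p`, so the normals there
are all given by the normalized gradient of the same function. -/
theorem continuousOn_outwardNormal (hD : IsC2Domain D) :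
    ContinuousOn (outwardNormal D) (frontier D) := by
  intro p hp
  obtain ⟨U, φ, hφ⟩ := hD.exists_defining p hp
  have hU : U ∈ 𝓝 p := hφ.isOpen.mem_nhds hφ.mem
  have hg : ContinuousAt (∇ φ) p := by
    have h1 : ContinuousAt (fderiv ℝ φ) p :=
      ((hφ.contDiffOn.contDiffAt hU).fderiv_right (m := 1) (by norm_num)).continuousAt
    exact ((InnerProductSpace.toDual ℝ (EuclideanSpace ℝ (Fin d))).symm.continuous.continuousAt).comp
      h1
  have hn : ContinuousAt (fun y => ‖∇ φ y‖⁻¹ • ∇ φ y) p :=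
    (hg.norm.inv₀ (norm_ne_zero_iff.2 hφ.gradient_ne_zero)).smul hg
  refine hn.continuousWithinAt.congr_of_eventuallyEq ?_
    (IsUnitOutwardNormal.outwardNormal_eq ⟨U, φ, hφ, rfl⟩)
  filter_upwards [self_mem_nhdsWithin, mem_nhdsWithin_of_mem_nhds hU,
    mem_nhdsWithin_of_mem_nhds (hg.eventually_ne hφ.gradient_ne_zero)] with y hy hyU hy0
  refine IsUnitOutwardNormal.outwardNormal_eq ⟨U, φ, ⟨hφ.isOpen, hyU, hφ.contDiffOn, hφ.mem_iff,
    ?_, hy0⟩, rfl⟩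
  have hUy : U ∈ 𝓝 y := hφ.isOpen.mem_nhds hyU
  -- `φ y ≤ 0` because `y` is a limit of points of `D`; `φ y < 0` is impossible because the open set
  -- `D` does not contain its boundary points.
  refine le_antisymm ?_ ?_
  · have hne : (𝓝[D ∩ U] y).NeBot := by
      rw [nhdsWithin_inter_of_mem' (mem_nhdsWithin_of_mem_nhds hUy)]
      exact mem_closure_iff_nhdsWithin_neBot.1 (frontier_subset_closure hy)
    refine le_of_tendsto (((hφ.contDiffOn.continuousOn.continuousAt hUy).tendsto).mono_left
      (nhdsWithin_le_nhds (s := D ∩ U))) ?_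
    filter_upwards [self_mem_nhdsWithin] with z hz
    exact ((hφ.mem_iff z hz.2).1 hz.1).le
  · by_contra hlt
    rw [hD.isOpen.frontier_eq] at hy
    exact hy.2 ((hφ.mem_iff y hyU).2 (not_le.1 hlt))

/-- Strict differentiability at `p` says exactly that `φ` minus its linear part has arbitrarily
small Lipschitz constant near `p`; dividing by the length of the gradient makes that linear part the
inner product with the normal. -/
theorem exists_flatChart (hD : IsC2Domain D) {p : EuclideanSpace ℝ (Fin d)} (hp : p ∈ frontier D)
    {ε : ℝ} (hε : 0 < ε) (hε' : ε ≤ 1 / 2) :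
    ∃ r φ, FlatChart D p (outwardNormal D p) r ε φ ∧
      ∀ y ∈ ball p r ∩ frontier D, ‖outwardNormal D y - outwardNormal D p‖ ≤ ε := by
  obtain ⟨U, φ, hφ⟩ := hD.exists_defining p hp
  have hU : U ∈ 𝓝 p := hφ.isOpen.mem_nhds hφ.mem
  have ha : 0 < ‖∇ φ p‖ := norm_pos_iff.2 hφ.gradient_ne_zero
  have he : outwardNormal D p = ‖∇ φ p‖⁻¹ • ∇ φ p :=
    IsUnitOutwardNormal.outwardNormal_eq ⟨U, φ, hφ, rfl⟩
  have hs : HasStrictFDerivAt φ (fderiv ℝ φ p) p :=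
    (hφ.contDiffOn.contDiffAt hU).hasStrictFDerivAt (by norm_num)
  have hs' := hs.isLittleO.def (mul_pos hε ha)
  rw [nhds_prod_eq] at hs'
  have hn := (hD.continuousOn_outwardNormal p hp).tendsto.eventually
    (Metric.closedBall_mem_nhds _ hε)
  obtain ⟨r, hr, hball⟩ := Metric.mem_nhds_iff.1 (Filter.inter_mem hU
    (Filter.inter_mem (eventually_nhdsWithin_iff.1 hn) (eventually_prod_self_iff'.1 hs').choose_spec.1))
  have hpair := (eventually_prod_self_iff'.1 hs').choose_spec.2
  refine ⟨r, fun y => ‖∇ φ p‖⁻¹ * φ y, ⟨hD.norm_outwardNormal hp, hr, hε, hε', ?_, ?_⟩, ?_⟩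
  · intro y hy
    rw [hφ.mem_iff y (hball hy).1, mul_neg_iff]
    have : 0 < ‖∇ φ p‖⁻¹ := inv_pos.2 ha
    constructor
    · exact fun h => Or.inl ⟨this, h⟩
    · rintro (h | h)
      · exact h.2
      · linarith [h.1]
  · intro y hy z hz
    have h1 := hpair y (hball hy).2.2 z (hball hz).2.2
    have h2 : inner ℝ (outwardNormal D p) (y - z) = ‖∇ φ p‖⁻¹ * fderiv ℝ φ p (y - z) := by
      rw [he, real_inner_smul_left]
      simp [gradient]
    simp only [] at h1
    rw [h2, ← mul_sub, ← mul_sub, abs_mul, abs_of_pos (inv_pos.2 ha), inv_mul_le_iff₀ ha]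
    rw [Real.norm_eq_abs] at h1
    linarith
  · rintro y ⟨hy, hyD⟩
    have := (hball hy).2.1 hyD
    rwa [← dist_eq_norm]

/-- Ensures that `fderivWithin` on the closure is determined by the function, so that normal
derivatives behave as expected. At a boundary point the flat chart provides an open convex cone
inside `D` with vertex at that point. -/
theorem uniqueDiffOn_closure (hD : IsC2Domain D) : UniqueDiffOn ℝ (closure D) := by
  intro p hp
  by_cases hpD : p ∈ D
  · exact (hD.isOpen.uniqueDiffWithinAt hpD).mono subset_closure
  have hpf : p ∈ frontier D := by rw [hD.isOpen.frontier_eq]; exact ⟨hp, hpD⟩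
  obtain ⟨r, φ, h, -⟩ := hD.exists_flatChart hpf (ε := 1 / 2) (by norm_num) le_rfl
  set e := outwardNormal D p
  have hφp : φ p = 0 := h.eq_zero_of_mem_frontier hD.isOpen (mem_ball_self h.radius_pos) hpf
  set C : Set (EuclideanSpace ℝ (Fin d)) :=
    {y | y ∈ ball p r ∧ inner ℝ e (y - p) + 1 / 2 * ‖y - p‖ < 0} with hC
  have hCD : C ⊆ D := by
    rintro y ⟨hy, hlt⟩
    have := (abs_le.1 (h.abs_sub_le y hy p (mem_ball_self h.radius_pos))).2
    exact (h.mem_iff y hy).2 (by linarith)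
  have hopen : IsOpen C := by
    apply isOpen_ball.inter
    have hc : Continuous fun y => inner ℝ e (y - p) + 1 / 2 * ‖y - p‖ := by fun_prop
    exact isOpen_lt hc continuous_const
  have hconv : Convex ℝ C := by
    apply (convex_ball p r).inter
    have : ConvexOn ℝ univ (fun y => inner ℝ e (y - p) + 1 / 2 * ‖y - p‖) := by
      refine ⟨convex_univ, fun y _ z _ a b ha hb hab => ?_⟩
      have hsub : a • y + b • z - p = a • (y - p) + b • (z - p) := by
        rw [smul_sub, smul_sub, sub_add_sub_comm, ← add_smul, hab, one_smul]
      simp only [hsub, inner_add_right, inner_smul_right, smul_eq_mul]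
      have := norm_add_le (a • (y - p)) (b • (z - p))
      rw [norm_smul, norm_smul, Real.norm_of_nonneg ha, Real.norm_of_nonneg hb] at this
      linarith
    intro y hy z hz a b ha hb hab
    exact (this.convex_lt 0 ⟨mem_univ y, hy⟩ ⟨mem_univ z, hz⟩ ha hb hab).2
  have hray : ∀ s ∈ Ioo 0 r, p - s • e ∈ C := by
    intro s hs
    have h1 : p - s • e - p = -(s • e) := by abel
    refine ⟨?_, ?_⟩
    · rw [mem_ball, dist_eq_norm, h1, norm_neg, norm_smul, h.norm_eq, Real.norm_of_nonneg hs.1.le,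
        mul_one]
      exact hs.2
    · rw [h1, norm_neg, inner_neg_right, inner_smul_right, norm_smul, h.norm_eq,
        Real.norm_of_nonneg hs.1.le, real_inner_self_eq_norm_sq, h.norm_eq]
      linarith [hs.1]
  have hcl : p ∈ closure C := by
    have ht : Tendsto (fun s : ℝ => p - s • e) (𝓝[>] 0) (𝓝 p) := by
      have : Continuous (fun s : ℝ => p - s • e) := by fun_prop
      simpa using (this.tendsto 0).mono_left nhdsWithin_le_nhds
    refine mem_closure_of_tendsto ht ?_
    filter_upwards [Ioo_mem_nhdsGT h.radius_pos] with s hs using hray s hs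
  refine (uniqueDiffWithinAt_convex hconv ?_ hcl).mono (hCD.trans subset_closure)
  rw [hopen.interior_eq]
  exact ⟨_, hray (r / 2) ⟨by linarith [h.radius_pos], by linarith [h.radius_pos]⟩⟩

end IsC2Domain

/-! ### Derivatives of the indicator function of `D` in cone and tangential directions. -/

theorem ContDiff.exists_norm_fderiv_le {E : Type*} [NormedAddCommGroup E] [NormedSpace ℝ E]
    {f : E → ℝ} (hf : ContDiff ℝ 1 f) (hc : HasCompactSupport f) :
    ∃ C, ∀ x, ‖fderiv ℝ f x‖ ≤ C :=
  (hc.fderiv ℝ).exists_bound_of_continuous (hf.continuous_fderiv (by norm_num))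

theorem ContDiff.integrable_fderiv_apply {E : Type*} [NormedAddCommGroup E] [NormedSpace ℝ E]
    [MeasurableSpace E] [BorelSpace E] {m : Measure E} [IsFiniteMeasureOnCompacts m]
    {f : E → ℝ} (hf : ContDiff ℝ 1 f) (hc : HasCompactSupport f) (w : E) :
    Integrable (fun x => fderiv ℝ f x w) m :=
  ((hf.continuous_fderiv (by norm_num)).clm_apply continuous_const).integrable_of_hasCompactSupport
    (hc.fderiv_apply ℝ w)

namespace FlatChart

open Metric Set Filter Topology

variable {E : Type*} [NormedAddCommGroup E] [InnerProductSpace ℝ E] [FiniteDimensional ℝ E]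
  [MeasurableSpace E] [BorelSpace E] {D : Set E} {p e : E} {r ε : ℝ} {φ : E → ℝ}

/-- The distributional derivative of the indicator function of `D` has a sign in directions close
to the normal. -/
theorem integral_fderiv_nonneg (h : FlatChart D p e r ε φ) (hDo : IsOpen D)
    (hDb : Bornology.IsBounded D) {f : E → ℝ} (hf : ContDiff ℝ 1 f) (hc : HasCompactSupport f)
    (hsupp : tsupport f ⊆ ball p r) (hf0 : ∀ x, 0 ≤ f x) {w : E}
    (hw : ε * ‖w‖ ≤ inner ℝ e w) : 0 ≤ ∫ x in D, fderiv ℝ f x w := by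
  have hfin : IsFiniteMeasure (volume.restrict D) := ⟨by
    rw [Measure.restrict_apply_univ]; exact hDb.measure_lt_top⟩
  have hfint : Integrable f := hf.continuous.integrable_of_hasCompactSupport hc
  obtain ⟨C, hC⟩ := hf.exists_norm_fderiv_le hc
  -- The integral in question is the derivative at `s = 0` of the mass of `f` over the translate `D
  -- + s • w`.
  have hder : HasDerivAt (fun s : ℝ => ∫ x in D, f (x + s • w)) (∫ x in D, fderiv ℝ f x w) 0 := by
    have := (hasDerivAt_integral_of_dominated_loc_of_deriv_le (μ := volume.restrict D)
      (F := fun (s : ℝ) x => f (x + s • w)) (F' := fun s x => fderiv ℝ f (x + s • w) w)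
      (x₀ := 0) (bound := fun _ => C * ‖w‖) univ_mem ?_ ?_ ?_ ?_ ?_ ?_).2
    · simpa using this
    · exact .of_forall fun s =>
        (hf.continuous.comp (continuous_id.add continuous_const)).aestronglyMeasurable
    · simpa [IntegrableOn] using hfint.integrableOn
    · exact (((hf.continuous_fderiv (by norm_num)).comp
        (continuous_id.add continuous_const)).clm_apply continuous_const).aestronglyMeasurable
    · exact .of_forall fun x s _ => ((fderiv ℝ f (x + s • w)).le_opNorm w).trans
        (mul_le_mul_of_nonneg_right (hC _) (norm_nonneg w))
    · exact integrable_const _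
    · refine .of_forall fun x s _ => ?_
      have h1 : HasDerivAt (fun s : ℝ => x + s • w) w s := by
        simpa using ((hasDerivAt_id s).smul_const w).const_add x
      exact ((hf.differentiable (by norm_num)) _).hasFDerivAt.comp_hasDerivAt s h1
  obtain ⟨δ, hδ, hthick⟩ := IsCompact.exists_thickening_subset_open hc isOpen_ball hsupp
  -- On the support of `f` the translate `D + s • w` contains `D`, because `φ` does not increase
  -- when one moves by `-s • w`; hence the mass does not decrease.
  have hmono : ∀ s : ℝ, 0 < s → s * ‖w‖ < δ →
      (∫ x in D, f (x + (0 : ℝ) • w)) ≤ ∫ x in D, f (x + s • w) := by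
    intro s hs hsδ
    rw [← integral_indicator hDo.measurableSet, ← integral_indicator hDo.measurableSet,
      ← integral_sub_right_eq_self (D.indicator fun x => f (x + s • w)) (s • w)]
    simp only [zero_smul, add_zero]
    refine integral_mono (hfint.indicator hDo.measurableSet) ?_ fun y => ?_
    · exact ((hfint.comp_add_right (s • w)).indicator hDo.measurableSet).comp_sub_right (s • w)
    by_cases hy : y ∈ D
    · by_cases hys : y ∈ tsupport f
      · have hmem : y - s • w ∈ ball p r := by
          apply hthick
          rw [mem_thickening_iff]
          refine ⟨y, hys, ?_⟩
          rw [dist_eq_norm, sub_sub_cancel_left, norm_neg, norm_smul, Real.norm_of_nonneg hs.le]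
          exact hsδ
        have hmD : y - s • w ∈ D := (h.mem_iff _ hmem).2
          ((h.le_add_of_inner hw (hsupp hys) hs.le hmem).trans_lt
            ((h.mem_iff y (hsupp hys)).1 hy))
        simp [indicator_of_mem hy, indicator_of_mem hmD]
      · rw [indicator_of_mem hy, image_eq_zero_of_notMem_tsupport hys]
        exact indicator_nonneg (fun _ _ => hf0 _) _
    · rw [indicator_of_notMem hy]
      exact indicator_nonneg (fun _ _ => hf0 _) _
  refine ge_of_tendsto hder.tendsto_slope_zero_right ?_
  have hsmall : ∀ᶠ s : ℝ in 𝓝[>] 0, s * ‖w‖ < δ := by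
    have : Tendsto (fun s : ℝ => s * ‖w‖) (𝓝[>] 0) (𝓝 0) := by
      have hc : Continuous fun s : ℝ => s * ‖w‖ := by fun_prop
      simpa using (hc.tendsto 0).mono_left nhdsWithin_le_nhds
    exact this.eventually (gt_mem_nhds hδ)
  filter_upwards [hsmall, self_mem_nhdsWithin] with s hs hs0
  rw [zero_add]
  exact smul_nonneg (inv_nonneg.2 (le_of_lt hs0)) (sub_nonneg.2 (hmono s hs0 hs))

/-- The tangential derivatives of the indicator function of `D` are small. -/
theorem abs_integral_fderiv_le (h : FlatChart D p e r ε φ) (hDo : IsOpen D)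
    (hDb : Bornology.IsBounded D) {f ψ : E → ℝ} {M : ℝ} (hf : ContDiff ℝ 1 f)
    (hψ : ContDiff ℝ 1 ψ) (hc : HasCompactSupport ψ)
    (hsupp : tsupport ψ ⊆ ball p r) (hle : ∀ x, |f x| ≤ M * ψ x) {t : E}
    (ht : inner ℝ e t = 0) (ht1 : ‖t‖ ≤ 1) :
    |∫ x in D, fderiv ℝ f x t| ≤ 2 * ε * M * ∫ x in D, fderiv ℝ ψ x e := by
  have hfs : Function.support f ⊆ Function.support ψ := fun x hx hx0 => hx (by
    have := hle x; rw [hx0, mul_zero] at this; exact abs_nonpos_iff.1 this)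
  have hfc : HasCompactSupport f := hc.mono hfs
  have key : ∀ t : E, inner ℝ e t = 0 → ‖t‖ ≤ 1 →
      0 ≤ 2 * ε * M * (∫ x in D, fderiv ℝ ψ x e) + ∫ x in D, fderiv ℝ f x t := by
    intro t ht ht1
    -- The tilt `2ε` is enough to bring a tangential vector of length at most 1 into the cone: `ε(2ε
    -- + 1) ≤ 2ε` since `ε ≤ 1/2`.
    have hw : ∀ u : E, inner ℝ e u = 0 → ‖u‖ ≤ 1 →
        ε * ‖(2 * ε) • e + u‖ ≤ inner ℝ e ((2 * ε) • e + u) := by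
      intro u hu hu1
      have h1 := norm_add_le ((2 * ε) • e) u
      rw [norm_smul, h.norm_eq, Real.norm_of_nonneg (by linarith [h.pos]), mul_one] at h1
      rw [inner_add_right, inner_smul_right, real_inner_self_eq_norm_sq, h.norm_eq, hu]
      nlinarith [h.pos, h.le_half]
    have hMψ : ContDiff ℝ 1 fun x => M * ψ x := contDiff_const.mul hψ
    have hs : ∀ g : E → ℝ, (∀ x, |g x| ≤ M * ψ x) → tsupport (fun x => M * ψ x + g x) ⊆ tsupport ψ :=
      fun g hg => closure_mono fun x hx hx0 => hx (by
        have := hg x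
        simp only [hx0, mul_zero] at this ⊢
        rw [abs_nonpos_iff.1 this, zero_add])
    have hn : ∀ x, |(-f) x| ≤ M * ψ x := fun x => by rw [Pi.neg_apply, abs_neg]; exact hle x
    have sA := (hs f hle).trans hsupp
    have sB := (hs (-f) hn).trans hsupp
    have cA := hc.of_isClosed_subset (isClosed_tsupport _) (hs f hle)
    have cB := hc.of_isClosed_subset (isClosed_tsupport _) (hs (-f) hn)
    have A := h.integral_fderiv_nonneg hDo hDb (hMψ.add hf) cA sA
      (fun x => by linarith [neg_abs_le (f x), hle x]) (hw t ht ht1)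
    have B := h.integral_fderiv_nonneg hDo hDb (hMψ.add hf.neg) cB sB
      (fun x => by linarith [le_abs_self (f x), hle x])
      (hw (-t) (by rw [inner_neg_right, ht, neg_zero]) (by rwa [norm_neg]))
    have hψd : ∀ x, DifferentiableAt ℝ ψ x := hψ.differentiable (by norm_num)
    have hfd : ∀ x, DifferentiableAt ℝ f x := hf.differentiable (by norm_num)
    -- Pairing `Mψ + f` with direction `2εe + t` and `Mψ - f` with `2εe - t` cancels the terms `∂ₑf`
    -- and `∂ₜψ`.
    have hsum : ∀ x, fderiv ℝ (fun x => M * ψ x + f x) x ((2 * ε) • e + t)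
        + fderiv ℝ (fun x => M * ψ x + -f x) x ((2 * ε) • e + -t) =
        2 * (2 * ε * M) * fderiv ℝ ψ x e + 2 * fderiv ℝ f x t := by
      intro x
      have e1 : HasFDerivAt (fun x => M * ψ x + f x) (M • fderiv ℝ ψ x + fderiv ℝ f x) x :=
        ((hψd x).hasFDerivAt.const_mul M).add (hfd x).hasFDerivAt
      have e2 : HasFDerivAt (fun x => M * ψ x + -f x) (M • fderiv ℝ ψ x + -fderiv ℝ f x) x :=
        ((hψd x).hasFDerivAt.const_mul M).add (hfd x).hasFDerivAt.neg
      rw [e1.fderiv, e2.fderiv]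
      simp only [_root_.add_apply, _root_.smul_apply, _root_.neg_apply, map_add, map_smul, map_neg,
        smul_eq_mul]
      ring
    have AB := add_nonneg A B
    rw [← integral_add ((hMψ.add hf).integrable_fderiv_apply cA _)
      ((hMψ.add hf.neg).integrable_fderiv_apply cB _)] at AB
    simp only [hsum] at AB
    rw [integral_add ((hψ.integrable_fderiv_apply hc e).const_mul _)
      ((hf.integrable_fderiv_apply hfc t).const_mul _), integral_const_mul,
      integral_const_mul] at AB
    linarith
  have k1 := key t ht ht1
  have k2 := key (-t) (by rw [inner_neg_right, ht, neg_zero]) (by rwa [norm_neg])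
  simp only [map_neg, integral_neg] at k2
  exact abs_le.2 ⟨by linarith, by linarith⟩

end FlatChart

/-! ### Slicing along lines parallel to `e`, and Hausdorff measure on the hyperplane. -/

/-- The orthogonal projection to the hyperplane orthogonal to `e`. -/
noncomputable abbrev hyperplaneProj {E : Type*} [NormedAddCommGroup E] [InnerProductSpace ℝ E]
    [FiniteDimensional ℝ E] (e : E) : E →L[ℝ] (Submodule.span ℝ {e})ᗮ :=
  (Submodule.span ℝ {e})ᗮ.orthogonalProjectionOnto

section Slicing

variable {E : Type*} [NormedAddCommGroup E] [InnerProductSpace ℝ E] [FiniteDimensional ℝ E]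

theorem coe_hyperplaneProj {e : E} (he : ‖e‖ = 1) (x : E) :
    (hyperplaneProj e x : E) = x - inner ℝ e x • e := by
  have h := Submodule.starProjection_add_starProjection_orthogonal (K := Submodule.span ℝ {e}) x
  rw [Submodule.starProjection_unit_singleton ℝ he x] at h
  rw [eq_sub_iff_add_eq, add_comm]
  exact h

theorem hyperplaneProj_smul_add {e : E} (he : ‖e‖ = 1) (s : ℝ) (y : (Submodule.span ℝ {e})ᗮ) :
    hyperplaneProj e (s • e + y) = y := by
  have hy : inner ℝ e (y : E) = 0 := Submodule.mem_orthogonal_singleton_iff_inner_right.1 y.2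
  ext
  rw [coe_hyperplaneProj he, inner_add_right, inner_smul_right, real_inner_self_eq_norm_sq, he, hy]
  simp

theorem smul_add_hyperplaneProj {e : E} (he : ‖e‖ = 1) (x : E) :
    inner ℝ e x • e + (hyperplaneProj e x : E) = x := by
  rw [coe_hyperplaneProj he]; abel

theorem norm_hyperplaneProj_le (e x : E) : ‖hyperplaneProj e x‖ ≤ ‖x‖ :=
  Submodule.norm_orthogonalProjectionOnto_apply_le _ x

variable [MeasurableSpace E] [BorelSpace E]

/-- The splitting of the space into a line and its orthogonal hyperplane. -/
noncomputable def lineProdHyperplane {e : E} (he : ‖e‖ = 1) :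
    ℝ × (Submodule.span ℝ {e})ᗮ ≃ᵐ E :=
  ((MeasurableEquiv.prodCongr
    (LinearIsometryEquiv.toSpanUnitSingleton (𝕜 := ℝ) e he).toHomeomorph.toMeasurableEquiv
    (MeasurableEquiv.refl _)).trans (MeasurableEquiv.toLp 2 _)).trans
    (Submodule.span ℝ {e}).orthogonalDecomposition.symm.toHomeomorph.toMeasurableEquiv

theorem lineProdHyperplane_apply {e : E} (he : ‖e‖ = 1)
    (q : ℝ × (Submodule.span ℝ {e})ᗮ) : lineProdHyperplane he q = q.1 • e + (q.2 : E) := by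
  simp [lineProdHyperplane, MeasurableEquiv.prodCongr]

theorem measurePreserving_lineProdHyperplane {e : E} (he : ‖e‖ = 1) :
    MeasurePreserving (lineProdHyperplane he) (volume.prod volume) volume := by
  have h1 : MeasurePreserving
      (LinearIsometryEquiv.toSpanUnitSingleton (𝕜 := ℝ) e he) volume volume :=
    LinearIsometryEquiv.measurePreserving _
  have h2 := h1.prod (MeasurePreserving.id (volume : Measure (Submodule.span ℝ {e})ᗮ))
  have h3 := (WithLp.volume_preserving_toLp (Submodule.span ℝ {e}) (Submodule.span ℝ {e})ᗮ).comp h2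
  exact ((Submodule.span ℝ {e}).orthogonalDecomposition.symm.measurePreserving).comp h3

theorem integral_eq_integral_integral_line {e : E} (he : ‖e‖ = 1) {G : E → ℝ}
    (hG : Integrable G) :
    Integrable (fun y : (Submodule.span ℝ {e})ᗮ => ∫ s : ℝ, G (s • e + y)) ∧
    ∫ x, G x = ∫ y : (Submodule.span ℝ {e})ᗮ, ∫ s : ℝ, G (s • e + y) := by
  have hm := measurePreserving_lineProdHyperplane he
  have hint : Integrable (fun q => G (lineProdHyperplane he q))
      ((volume : Measure ℝ).prod (volume : Measure (Submodule.span ℝ {e})ᗮ)) :=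
    (hm.integrable_comp_emb (lineProdHyperplane he).measurableEmbedding).2 hG
  have e1 := hm.integral_comp (lineProdHyperplane he).measurableEmbedding G
  simp only [lineProdHyperplane_apply] at e1 hint
  refine ⟨hint.integral_prod_right, ?_⟩
  rw [← e1, integral_prod_symm _ hint]

/-- This is where the normalization of the Hausdorff measure matters: it makes the comparison
constants below tend to 1 as ε tends to 0. -/
theorem volume_hyperplane {e : E} (he : ‖e‖ = 1) :
    (volume : Measure (Submodule.span ℝ {e})ᗮ) =
      Measure.euclideanHausdorffMeasure (Module.finrank ℝ E - 1) := by
  rw [← InnerProductSpace.euclideanHausdorffMeasure_eq_volume]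
  congr 1
  have h1 := Submodule.finrank_add_finrank_orthogonal (Submodule.span ℝ {e})
  rw [finrank_span_singleton (by rintro rfl; simp at he)] at h1
  omega

end Slicing

theorem LipschitzOnWith.euclideanHausdorffMeasure_image_le {X Y : Type*} [MetricSpace X] [MeasurableSpace X]
    [BorelSpace X] [MetricSpace Y] [MeasurableSpace Y] [BorelSpace Y] {K : NNReal} {g : X → Y}
    {s : Set X} (hg : LipschitzOnWith K g s) (n : ℕ) :
    Measure.euclideanHausdorffMeasure n (g '' s)
      ≤ (K : ENNReal) ^ n * Measure.euclideanHausdorffMeasure n s := by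
  simp only [Measure.euclideanHausdorffMeasure_def, Measure.smul_apply, ENNReal.smul_def,
    smul_eq_mul]
  have := hg.hausdorffMeasure_image_le (d := n) (by positivity)
  rw [ENNReal.rpow_natCast] at this
  calc _ ≤ _ * ((K : ENNReal) ^ n * Measure.hausdorffMeasure (n : ℝ) s) := by gcongr
    _ = _ := by ring

theorem HasCompactSupport.integral_deriv_eq_zero {q : ℝ → ℝ} (hq : ContDiff ℝ 1 q)
    (hc : HasCompactSupport q) : ∫ s, deriv q s = 0 := by
  have hi : Integrable (deriv q) :=
    (hq.continuous_deriv le_rfl).integrable_of_hasCompactSupport hc.deriv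
  rw [← intervalIntegral.integral_Iic_add_Ioi (b := 0) hi.integrableOn hi.integrableOn,
    hc.integral_Iic_deriv_eq hq, hc.integral_Ioi_deriv_eq hq, add_neg_cancel]

section line

variable {E : Type*} [NormedAddCommGroup E] [InnerProductSpace ℝ E] {f : E → ℝ}

theorem contDiff_line (hf : ContDiff ℝ 1 f) (e y : E) : ContDiff ℝ 1 fun s : ℝ => f (s • e + y) :=
  hf.comp ((contDiff_id.smul contDiff_const).add contDiff_const)

theorem deriv_line (hf : ContDiff ℝ 1 f) (e y : E) (s : ℝ) :
    deriv (fun s : ℝ => f (s • e + y)) s = fderiv ℝ f (s • e + y) e := by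
  have h1 : HasDerivAt (fun s : ℝ => s • e + y) e s := by
    simpa using ((hasDerivAt_id s).smul_const e).add_const y
  exact (((hf.differentiable (by norm_num)) _).hasFDerivAt.comp_hasDerivAt s h1).deriv

theorem hasCompactSupport_line (hc : HasCompactSupport f) {e : E} (he : ‖e‖ = 1) (y : E) :
    HasCompactSupport fun s : ℝ => f (s • e + y) := by
  refine hc.comp_isClosedEmbedding (g := fun s : ℝ => s • e + y) ?_
  have : Isometry fun s : ℝ => s • e + y := by
    refine Isometry.of_dist_eq fun a b => ?_
    rw [dist_add_right, dist_eq_norm, ← sub_smul, norm_smul, he, mul_one, Real.dist_eq,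
      Real.norm_eq_abs]
  exact this.isClosedEmbedding

end line

/-! ### Flux in direction `e` against the surface measure. -/

namespace FlatChart

open Metric Set Filter Topology

variable {E : Type*} [NormedAddCommGroup E] [InnerProductSpace ℝ E]
  {D : Set E} {p e : E} {r ε : ℝ} {φ : E → ℝ}

section line

variable {f : E → ℝ}

/-- Inside the ball `φ` is strictly increasing along the line, so `D` occupies precisely the
parameters `s < s₀` there; the fundamental theorem of calculus leaves the value of `f` at the
crossing point. -/
theorem integral_line_of_mem (h : FlatChart D p e r ε φ) (hDo : IsOpen D) (hf : ContDiff ℝ 1 f)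
    (hc : HasCompactSupport f) (hsupp : tsupport f ⊆ ball p r) {y : E} {s₀ : ℝ}
    (hb : s₀ • e + y ∈ ball p r) (hfr : s₀ • e + y ∈ frontier D) :
    ∫ s : ℝ, D.indicator (fun x => fderiv ℝ f x e) (s • e + y) = f (s₀ • e + y) := by
  have h0 := h.eq_zero_of_mem_frontier hDo hb hfr
  have hpt : ∀ s : ℝ, D.indicator (fun x => fderiv ℝ f x e) (s • e + y) =
      (Iio s₀).indicator (deriv fun s : ℝ => f (s • e + y)) s := by
    intro s
    by_cases hs : s • e + y ∈ ball p r
    · by_cases hlt : s < s₀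
      · have hm : s • e + y = (s₀ • e + y) - (s₀ - s) • e := by rw [sub_smul]; abel
        have hD : s • e + y ∈ D := by
          rw [h.mem_iff _ hs, ← h0, hm]
          exact h.lt_of_inner hb (sub_pos.2 hlt) (hm ▸ hs)
        rw [indicator_of_mem hD, indicator_of_mem (mem_Iio.2 hlt), deriv_line hf]
      · have hD : s • e + y ∉ D := by
          rw [h.mem_iff _ hs, not_lt, ← h0]
          rcases (not_lt.1 hlt).eq_or_lt with heq | hgt
          · rw [heq]
          · have hm : s₀ • e + y = (s • e + y) - (s - s₀) • e := by rw [sub_smul]; abel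
            rw [hm]
            exact (h.lt_of_inner hs (sub_pos.2 hgt) (hm ▸ hb)).le
        rw [indicator_of_notMem hD, indicator_of_notMem (by simpa using hlt)]
    · have hz : fderiv ℝ f (s • e + y) = 0 :=
        fderiv_of_notMem_tsupport ℝ fun hmem => hs (hsupp hmem)
      classical
      rw [indicator_apply, indicator_apply, deriv_line hf, hz]
      simp
  simp only [hpt]
  rw [integral_indicator measurableSet_Iio, ← integral_Iic_eq_integral_Iio,
    (hasCompactSupport_line hc h.norm_eq y).integral_Iic_deriv_eq (contDiff_line hf e y)]

/-- The part of the line in the ball is connected and misses the boundary, so it lies either inside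
`D` or outside it. The integral is then that of the derivative of a compactly supported function, or
of zero. -/
theorem integral_line_of_disjoint (h : FlatChart D p e r ε φ) (hDo : IsOpen D)
    (hf : ContDiff ℝ 1 f)
    (hc : HasCompactSupport f) (hsupp : tsupport f ⊆ ball p r) {y : E}
    (hfr : ∀ s : ℝ, s • e + y ∈ ball p r → s • e + y ∉ frontier D) :
    ∫ s : ℝ, D.indicator (fun x => fderiv ℝ f x e) (s • e + y) = 0 := by
  have hz : ∀ s : ℝ, s • e + y ∉ ball p r → fderiv ℝ f (s • e + y) e = 0 := fun s hs => by
    rw [fderiv_of_notMem_tsupport ℝ fun hmem => hs (hsupp hmem)]; simp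
  set I : Set ℝ := {s | s • e + y ∈ ball p r}
  have hI : Convex ℝ I := by
    intro a ha b hb u v hu hv huv
    have : (u • a + v • b) • e + y = u • (a • e + y) + v • (b • e + y) := by
      rw [smul_add, smul_add, add_add_add_comm, ← add_smul u v y, huv, one_smul, add_smul,
        smul_assoc, smul_assoc]
    change (u • a + v • b) • e + y ∈ ball p r
    rw [this]
    exact convex_ball p r ha hb hu hv huv
  have hpre : IsPreconnected ((fun s : ℝ => s • e + y) '' I) :=
    hI.isPreconnected.image _ (by fun_prop)
  by_cases hne : (((fun s : ℝ => s • e + y) '' I) ∩ D).Nonempty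
  · have hsub : (fun s : ℝ => s • e + y) '' I ⊆ D := by
      refine hpre.subset_of_closure_inter_subset hDo hne ?_
      rintro _ ⟨hcl, s, hs, rfl⟩
      by_contra hnD
      exact hfr s hs (by rw [hDo.frontier_eq]; exact ⟨hcl, hnD⟩)
    have hpt : ∀ s : ℝ, D.indicator (fun x => fderiv ℝ f x e) (s • e + y) =
        deriv (fun s : ℝ => f (s • e + y)) s := by
      intro s
      rw [deriv_line hf]
      by_cases hs : s ∈ I
      · rw [indicator_of_mem (hsub ⟨s, hs, rfl⟩)]
      · classical
        rw [indicator_apply, hz s hs, ite_self]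
    simp only [hpt]
    exact (hasCompactSupport_line hc h.norm_eq y).integral_deriv_eq_zero (contDiff_line hf e y)
  · have hpt : ∀ s : ℝ, D.indicator (fun x => fderiv ℝ f x e) (s • e + y) = 0 := by
      intro s
      by_cases hs : s ∈ I
      · exact indicator_of_notMem (fun hD => hne ⟨_, ⟨s, hs, rfl⟩, hD⟩) _
      · classical
        rw [indicator_apply, hz s hs, ite_self]
    simp only [hpt, integral_zero]

end line

variable [FiniteDimensional ℝ E] [MeasurableSpace E] [BorelSpace E]

/-- The projection of a boundary piece to the hyperplane does not increase the measure. -/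
theorem volume_image_le (h : FlatChart D p e r ε φ) (A : Set E) :
    volume (hyperplaneProj e '' A) ≤
      Measure.euclideanHausdorffMeasure (Module.finrank ℝ E - 1) A := by
  rw [volume_hyperplane h.norm_eq]
  have : LipschitzOnWith 1 (hyperplaneProj e) A :=
    (Submodule.lipschitzWith_orthogonalProjectionOnto _).lipschitzOnWith
  simpa using this.euclideanHausdorffMeasure_image_le (Module.finrank ℝ E - 1)

/-- By `norm_sub_le` the projection is injective on the boundary piece with inverse Lipschitz of
constant `(1 - ε)⁻¹`. -/
theorem measure_le_volume_image (h : FlatChart D p e r ε φ) (hDo : IsOpen D) {A : Set E}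
    (hA : A ⊆ frontier D ∩ ball p r) :
    Measure.euclideanHausdorffMeasure (Module.finrank ℝ E - 1) A ≤
      ENNReal.ofReal (((1 - ε)⁻¹) ^ (Module.finrank ℝ E - 1)) * volume (hyperplaneProj e '' A) := by
  have hK : 0 ≤ (1 - ε)⁻¹ := inv_nonneg.2 (by linarith [h.le_half])
  have hbound : ∀ x ∈ A, ∀ y ∈ A,
      dist x y ≤ (Real.toNNReal (1 - ε)⁻¹ : ℝ) * dist (hyperplaneProj e x) (hyperplaneProj e y) := by
    intro x hx y hy
    have h1 := h.norm_sub_le hDo (hA hx).2 (hA hx).1 (hA hy).2 (hA hy).1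
    have h2 : ‖hyperplaneProj e (x - y)‖ = ‖(x - y) - inner ℝ e (x - y) • e‖ := by
      rw [← coe_hyperplaneProj h.norm_eq]; rfl
    rw [Real.coe_toNNReal _ hK, dist_eq_norm, dist_eq_norm, ← map_sub, h2, ← div_eq_inv_mul, le_div_iff₀ (by linarith [h.le_half])]
    linarith
  have hinj : InjOn (hyperplaneProj e) A := fun x hx y hy hxy => by
    have := hbound x hx y hy
    rw [hxy, dist_self, mul_zero] at this
    exact dist_le_zero.1 this
  have hlip : LipschitzOnWith (Real.toNNReal (1 - ε)⁻¹) (Function.invFunOn (hyperplaneProj e) A)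
      (hyperplaneProj e '' A) := by
    refine LipschitzOnWith.of_dist_le_mul ?_
    rintro _ ⟨x, hx, rfl⟩ _ ⟨y, hy, rfl⟩
    rw [hinj.leftInvOn_invFunOn hx, hinj.leftInvOn_invFunOn hy]
    exact hbound x hx y hy
  have := hlip.euclideanHausdorffMeasure_image_le (Module.finrank ℝ E - 1)
  rw [hinj.leftInvOn_invFunOn.image_image, ← volume_hyperplane h.norm_eq] at this
  rwa [ENNReal.ofReal_pow hK]

theorem measure_frontier_lt_top (h : FlatChart D p e r ε φ) (hDo : IsOpen D) :
    Measure.euclideanHausdorffMeasure (Module.finrank ℝ E - 1) (frontier D ∩ ball p r) < ⊤ := by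
  refine (h.measure_le_volume_image hDo Subset.rfl).trans_lt
    (ENNReal.mul_lt_top ENNReal.ofReal_lt_top ?_)
  refine Bornology.IsBounded.measure_lt_top ?_
  exact ((Submodule.lipschitzWith_orthogonalProjectionOnto (Submodule.span ℝ {e})ᗮ).isBounded_image
    (isBounded_ball.subset inter_subset_right))

/-- The flux of the indicator function of `D` in the direction `e` is close to the surface
measure of the boundary. -/
theorem integral_fderiv_le_and_le (h : FlatChart D p e r ε φ) (hDo : IsOpen D) {f : E → ℝ}
    (hf : ContDiff ℝ 1 f) (hc : HasCompactSupport f)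
    (hsupp : tsupport f ⊆ ball p r) (hf0 : ∀ x, 0 ≤ f x) :
    ∫ x in D, fderiv ℝ f x e ≤ ∫ x in frontier D, f x
        ∂(Measure.euclideanHausdorffMeasure (Module.finrank ℝ E - 1)) ∧
      ∫ x in frontier D, f x ∂(Measure.euclideanHausdorffMeasure (Module.finrank ℝ E - 1)) ≤
        ((1 - ε)⁻¹) ^ (Module.finrank ℝ E - 1) * ∫ x in D, fderiv ℝ f x e := by
  set n := Module.finrank ℝ E - 1
  set σ : Measure E := Measure.euclideanHausdorffMeasure n
  set S := frontier D ∩ ball p r with hS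
  set π := hyperplaneProj e
  have hSm : MeasurableSet S := isClosed_frontier.measurableSet.inter measurableSet_ball
  have hK : 0 ≤ ((1 - ε)⁻¹) ^ n := pow_nonneg (inv_nonneg.2 (by linarith [h.le_half])) _
  obtain ⟨hΦi, hΦ⟩ := integral_eq_integral_integral_line h.norm_eq
    ((hf.integrable_fderiv_apply (m := volume) hc e).indicator hDo.measurableSet)
  set Φ : (Submodule.span ℝ {e})ᗮ → ℝ := fun y =>
    ∫ s : ℝ, D.indicator (fun x => fderiv ℝ f x e) (s • e + y) with hΦdef
  rw [integral_indicator hDo.measurableSet] at hΦ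
  have hΦS : ∀ x ∈ S, Φ (π x) = f x := by
    intro x hx
    have hx' := smul_add_hyperplaneProj h.norm_eq x
    have := h.integral_line_of_mem hDo hf hc hsupp (s₀ := inner ℝ e x) (y := hyperplaneProj e x)
      (by rw [hx']; exact hx.2) (by rw [hx']; exact hx.1)
    rwa [hx'] at this
  have hΦ0 : ∀ y, y ∉ π '' S → Φ y = 0 := by
    intro y hy
    refine h.integral_line_of_disjoint hDo hf hc hsupp fun s hs hfr => hy ?_
    exact ⟨s • e + y, ⟨hfr, hs⟩, hyperplaneProj_smul_add h.norm_eq s y⟩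
  have hΦnn : ∀ y, 0 ≤ Φ y := by
    intro y
    by_cases hy : y ∈ π '' S
    · obtain ⟨x, hx, rfl⟩ := hy
      rw [hΦS x hx]; exact hf0 x
    · rw [hΦ0 y hy]
  have hπ : Measurable π := π.continuous.measurable
  -- Together with `hle2`, the pushforward of the surface measure is squeezed between Lebesgue
  -- measure on the projected piece and a multiple of it.
  have hle1 : volume.restrict (π '' S) ≤ (σ.restrict S).map π := by
    refine Measure.le_iff.2 fun B hB => ?_
    rw [Measure.restrict_apply hB, Measure.map_apply hπ hB, Measure.restrict_apply (hπ hB)]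
    refine le_trans (measure_mono ?_) (h.volume_image_le _)
    rintro _ ⟨hB, x, hx, rfl⟩
    exact ⟨x, ⟨hB, hx⟩, rfl⟩
  have hle2 : (σ.restrict S).map π ≤ ENNReal.ofReal (((1 - ε)⁻¹) ^ n) • volume.restrict (π '' S) := by
    refine Measure.le_iff.2 fun B hB => ?_
    rw [Measure.smul_apply, smul_eq_mul, Measure.restrict_apply hB, Measure.map_apply hπ hB,
      Measure.restrict_apply (hπ hB)]
    refine (h.measure_le_volume_image hDo inter_subset_right).trans ?_
    gcongr
    rintro _ ⟨x, ⟨hB, hx⟩, rfl⟩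
    exact ⟨hB, x, hx, rfl⟩
  have hΦsm : Integrable Φ (ENNReal.ofReal (((1 - ε)⁻¹) ^ n) • volume.restrict (π '' S)) :=
    hΦi.integrableOn.smul_measure ENNReal.ofReal_ne_top
  have hΦmap : Integrable Φ ((σ.restrict S).map π) := hΦsm.mono_measure hle2
  -- On the boundary piece `f = Φ ∘ π`, so the surface integral becomes one of `Φ` against the
  -- pushforward.
  have eS : ∫ x in frontier D, f x ∂σ = ∫ y, Φ y ∂((σ.restrict S).map π) := by
    rw [integral_map hπ.aemeasurable hΦmap.1,
      setIntegral_congr_fun hSm (fun x hx => hΦS x hx)]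
    exact setIntegral_eq_of_subset_of_forall_sdiff_eq_zero isClosed_frontier.measurableSet
      inter_subset_left fun x hx => image_eq_zero_of_notMem_tsupport
        fun hmem => hx.2 ⟨hx.1, hsupp hmem⟩
  have eV : ∫ x in D, fderiv ℝ f x e = ∫ y in π '' S, Φ y := by
    rw [hΦ, setIntegral_eq_integral_of_forall_compl_eq_zero hΦ0]
  rw [eS, eV]
  constructor
  · exact integral_mono_measure hle1 (.of_forall hΦnn) hΦmap
  · have := integral_mono_measure hle2 (.of_forall hΦnn) hΦsm
    rwa [integral_smul_measure, ENNReal.toReal_ofReal hK, smul_eq_mul] at this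

end FlatChart

/-! ### The divergence theorem in a chart, with error, for globally `C¹` fields. -/

namespace FlatChart

open Metric Set Filter Topology

variable {E : Type*} [NormedAddCommGroup E] [InnerProductSpace ℝ E] [FiniteDimensional ℝ E]
  [MeasurableSpace E] [BorelSpace E] {D : Set E} {p e : E} {r ε : ℝ} {φ : E → ℝ}

/-- The surface integral is compared with the flux in the direction `e` for functions of
arbitrary sign. -/
theorem abs_integral_sub_le (h : FlatChart D p e r ε φ) (hDo : IsOpen D) {σ : Measure E}
    (hσ : σ = Measure.euclideanHausdorffMeasure (Module.finrank ℝ E - 1))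
    [IsFiniteMeasure (σ.restrict (frontier D))] {f ψ : E → ℝ} {M : ℝ} (hM : 0 ≤ M)
    (hf : ContDiff ℝ 1 f) (hψ : ContDiff ℝ 1 ψ) (hc : HasCompactSupport ψ)
    (hsupp : tsupport ψ ⊆ ball p r) (hψ0 : ∀ x, 0 ≤ ψ x) (hle : ∀ x, |f x| ≤ M * ψ x) :
    |(∫ x in D, fderiv ℝ f x e) - ∫ x in frontier D, f x ∂σ| ≤
      (((1 - ε)⁻¹) ^ (Module.finrank ℝ E - 1) - 1) * M * ∫ x in frontier D, ψ x ∂σ := by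
  have hfc : HasCompactSupport f := hc.mono fun x hx hx0 => hx (by
    have := hle x; rw [hx0, mul_zero] at this; exact abs_nonpos_iff.1 this)
  have hMψ : ContDiff ℝ 1 fun x => M * ψ x := contDiff_const.mul hψ
  have hψd : ∀ x, DifferentiableAt ℝ ψ x := hψ.differentiable (by norm_num)
  have iψ : Integrable ψ (σ.restrict (frontier D)) :=
    hψ.continuous.integrable_of_hasCompactSupport hc
  have idψ : Integrable (fun x => fderiv ℝ ψ x e) (volume.restrict D) :=
    hψ.integrable_fderiv_apply hc e
  -- The functional "surface integral minus flux" is nonnegative on nonnegative functions; evaluated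
  -- at `Mψ + g` and used for `g = ±f`, it is bounded on `f` by `M` times its value on `ψ`.
  have key : ∀ g : E → ℝ, ContDiff ℝ 1 g → HasCompactSupport g → (∀ x, |g x| ≤ M * ψ x) →
      0 ≤ (M * (∫ x in frontier D, ψ x ∂σ) + ∫ x in frontier D, g x ∂σ) -
        (M * (∫ x in D, fderiv ℝ ψ x e) + ∫ x in D, fderiv ℝ g x e) := by
    intro g hg hgc hgle
    have hs : tsupport (fun x => M * ψ x + g x) ⊆ tsupport ψ :=
      closure_mono fun x hx hx0 => hx (by
        have := hgle x
        simp only [hx0, mul_zero] at this ⊢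
        rw [abs_nonpos_iff.1 this, zero_add])
    have := (h.integral_fderiv_le_and_le hDo (hMψ.add hg)
      (hc.of_isClosed_subset (isClosed_tsupport _) hs) (hs.trans hsupp)
      (fun x => by linarith [neg_abs_le (g x), hgle x])).1
    have hd : ∀ x, fderiv ℝ (fun x => M * ψ x + g x) x e =
        M * fderiv ℝ ψ x e + fderiv ℝ g x e := by
      intro x
      have e1 : HasFDerivAt (fun x => M * ψ x + g x) (M • fderiv ℝ ψ x + fderiv ℝ g x) x :=
        ((hψd x).hasFDerivAt.const_mul M).add
          (hg.differentiable (by norm_num) x).hasFDerivAt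
      rw [e1.fderiv]
      rfl
    simp only [hd] at this
    rw [← hσ, integral_add (idψ.const_mul M) (hg.integrable_fderiv_apply hgc e),
      integral_add (iψ.const_mul M) (hg.continuous.integrable_of_hasCompactSupport hgc),
      integral_const_mul, integral_const_mul] at this
    linarith
  have k1 := key f hf hfc hle
  have k2 := key (fun x => -f x) hf.neg hfc.neg (fun x => by rw [abs_neg]; exact hle x)
  simp only [fderiv_fun_neg, _root_.neg_apply, integral_neg] at k2
  have hψle := h.integral_fderiv_le_and_le hDo hψ hc hsupp hψ0
  rw [← hσ] at hψle
  have hK : 1 ≤ ((1 - ε)⁻¹) ^ (Module.finrank ℝ E - 1) :=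
    one_le_pow₀ ((one_le_inv₀ (by linarith [h.le_half])).2 (by linarith [h.pos]))
  have hfin : M * (∫ x in frontier D, ψ x ∂σ) - M * (∫ x in D, fderiv ℝ ψ x e) ≤
      (((1 - ε)⁻¹) ^ (Module.finrank ℝ E - 1) - 1) * M * ∫ x in frontier D, ψ x ∂σ := by
    have h3 : (∫ x in frontier D, ψ x ∂σ) - (∫ x in D, fderiv ℝ ψ x e) ≤
        (((1 - ε)⁻¹) ^ (Module.finrank ℝ E - 1) - 1) * ∫ x in frontier D, ψ x ∂σ := by
      nlinarith [hψle.1, hψle.2]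
    nlinarith
  exact abs_le.2 ⟨by linarith, by linarith⟩

/-- The divergence theorem in a chart, up to an error controlled by `ε`. -/
theorem abs_integral_divergence_sub_le (h : FlatChart D p e r ε φ) (hDo : IsOpen D)
    (hDb : Bornology.IsBounded D) {σ : Measure E}
    (hσ : σ = Measure.euclideanHausdorffMeasure (Module.finrank ℝ E - 1))
    [IsFiniteMeasure (σ.restrict (frontier D))] {ι : Type*} [Fintype ι]
    (b : OrthonormalBasis ι ℝ E) {ν : E → E} (hν : ContinuousOn ν (frontier D))
    (hνe : ∀ y ∈ ball p r ∩ frontier D, ‖ν y - e‖ ≤ ε) {H : E → E} {ψ : E → ℝ} {M : ℝ}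
    (hM : 0 ≤ M) (hH : ContDiff ℝ 1 H) (hψ : ContDiff ℝ 1 ψ) (hc : HasCompactSupport ψ)
    (hsupp : tsupport ψ ⊆ ball p r) (hψ0 : ∀ x, 0 ≤ ψ x) (hle : ∀ x, ‖H x‖ ≤ M * ψ x) :
    |(∫ x in D, ∑ i, inner ℝ (b i) (fderiv ℝ H x (b i)))
        - ∫ x in frontier D, inner ℝ (H x) (ν x) ∂σ| ≤
      (2 * ε * Fintype.card ι + (((1 - ε)⁻¹) ^ (Module.finrank ℝ E - 1) - 1) + ε) * M *
        ∫ x in frontier D, ψ x ∂σ := by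
  have hHs : Function.support H ⊆ Function.support ψ := fun x hx hx0 => hx (by
    have := hle x; rw [hx0, mul_zero] at this; exact norm_le_zero_iff.1 this)
  have hHc : HasCompactSupport H := hc.mono hHs
  have hHd : ∀ x, DifferentiableAt ℝ H x := hH.differentiable (by norm_num)
  have hcomp : ∀ v : E, ContDiff ℝ 1 fun x => inner ℝ v (H x) := fun v =>
    contDiff_const.inner ℝ hH
  have hcompc : ∀ v : E, HasCompactSupport fun x => inner ℝ v (H x) := fun v =>
    hHc.mono fun x hx hx0 => hx (by simp only [hx0, inner_zero_right])
  have hcompd : ∀ v x w, fderiv ℝ (fun x => inner ℝ v (H x)) x w = inner ℝ v (fderiv ℝ H x w) := by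
    intro v x w
    have : HasFDerivAt (fun x => inner ℝ v (H x)) ((innerSL ℝ v).comp (fderiv ℝ H x)) x :=
      (innerSL ℝ v).hasFDerivAt.comp x (hHd x).hasFDerivAt
    rw [this.fderiv]
    rfl
  have hcomple : ∀ v : E, ‖v‖ ≤ 1 → ∀ x, |inner ℝ v (H x)| ≤ M * ψ x := fun v hv x =>
    (abs_real_inner_le_norm _ _).trans
      ((mul_le_of_le_one_left (norm_nonneg _) hv).trans (hle x))
  -- Tangential part of the basis vector `b i`.
  set t : ι → E := fun i => b i - inner ℝ e (b i) • e with ht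
  have hte : ∀ i, inner ℝ e (t i) = 0 := by
    intro i
    rw [ht, inner_sub_right, inner_smul_right, real_inner_self_eq_norm_sq, h.norm_eq]
    ring
  have ht1 : ∀ i, ‖t i‖ ≤ 1 := by
    intro i
    have := norm_hyperplaneProj_le e (b i)
    rw [b.norm_eq_one] at this
    rwa [← Submodule.norm_coe, coe_hyperplaneProj h.norm_eq] at this
  -- Inserting `b i = ⟪e, b i⟫ e + t i` in the derivative direction, the normal parts recombine to
  -- `∂ₑ⟪e, H⟫` by expansion of `e` in the basis; only tangential derivatives remain.
  have hdiv : ∀ x, ∑ i, inner ℝ (b i) (fderiv ℝ H x (b i)) =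
      fderiv ℝ (fun x => inner ℝ e (H x)) x e
        + ∑ i, fderiv ℝ (fun x => inner ℝ (b i) (H x)) x (t i) := by
    intro x
    simp only [hcompd]
    rw [← b.sum_inner_mul_inner e, ← Finset.sum_add_distrib]
    refine Finset.sum_congr rfl fun i _ => ?_
    rw [ht, map_sub, map_smul, inner_sub_right, inner_smul_right]
    ring
  have hi : ∀ v w : E, Integrable (fun x => fderiv ℝ (fun x => inner ℝ v (H x)) x w)
      (volume.restrict D) := fun v w => (hcomp v).integrable_fderiv_apply (hcompc v) w
  simp only [hdiv]
  rw [integral_add (hi e e) (integrable_finsetSum _ fun i _ => hi (b i) (t i)),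
    integral_finsetSum _ fun i _ => hi (b i) (t i)]
  have hΛ := (h.integral_fderiv_le_and_le hDo hψ hc hsupp hψ0).1
  rw [← hσ] at hΛ
  have hI0 : 0 ≤ ∫ x in frontier D, ψ x ∂σ := integral_nonneg hψ0
  have b1 : |∑ i, ∫ x in D, fderiv ℝ (fun x => inner ℝ (b i) (H x)) x (t i)| ≤
      2 * ε * Fintype.card ι * M * ∫ x in frontier D, ψ x ∂σ := by
    refine (Finset.abs_sum_le_sum_abs _ _).trans ?_
    refine (Finset.sum_le_card_nsmul _ _ (2 * ε * M * ∫ x in frontier D, ψ x ∂σ)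
      fun i _ => ?_).trans_eq ?_
    · refine (h.abs_integral_fderiv_le hDo hDb (hcomp (b i)) hψ hc hsupp
        (hcomple _ (b.norm_eq_one i).le) (hte i) (ht1 i)).trans ?_
      have := h.pos
      gcongr
    · rw [Finset.card_univ, nsmul_eq_mul]; ring
  have b2 := h.abs_integral_sub_le hDo hσ hM (hcomp e) hψ hc hsupp hψ0
    (hcomple e h.norm_eq.le)
  have iψ : Integrable ψ (σ.restrict (frontier D)) :=
    hψ.continuous.integrable_of_hasCompactSupport hc
  have ie : Integrable (fun x => inner ℝ e (H x)) (σ.restrict (frontier D)) :=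
    (hcomp e).continuous.integrable_of_hasCompactSupport (hcompc e)
  have hpt : ∀ x ∈ frontier D, |inner ℝ e (H x) - inner ℝ (H x) (ν x)| ≤ ε * M * ψ x := by
    intro x hx
    by_cases hxs : x ∈ tsupport ψ
    · rw [real_inner_comm, ← inner_sub_right]
      refine (abs_real_inner_le_norm _ _).trans ?_
      rw [norm_sub_rev]
      have h1 := hνe x ⟨hsupp hxs, hx⟩
      have h2 := hle x
      calc ‖H x‖ * ‖ν x - e‖ ≤ (M * ψ x) * ε := by gcongr; exact (norm_nonneg _).trans h2
        _ = _ := by ring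
    · have h1 : H x = 0 := by
        by_contra hne
        exact hxs (subset_tsupport _ (hHs hne))
      rw [h1, image_eq_zero_of_notMem_tsupport hxs]
      simp
  have hmeas : AEStronglyMeasurable (fun x => inner ℝ e (H x) - inner ℝ (H x) (ν x))
      (σ.restrict (frontier D)) :=
    ie.1.sub (hH.continuous.aestronglyMeasurable.inner
      (hν.aestronglyMeasurable isClosed_frontier.measurableSet))
  have id : Integrable (fun x => inner ℝ e (H x) - inner ℝ (H x) (ν x))
      (σ.restrict (frontier D)) := by
    refine (iψ.const_mul (ε * M)).mono' hmeas ?_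
    exact (ae_restrict_iff' isClosed_frontier.measurableSet).2 (.of_forall hpt)
  have iν : Integrable (fun x => inner ℝ (H x) (ν x)) (σ.restrict (frontier D)) := by
    refine (ie.sub id).congr (.of_forall fun x => ?_)
    simp
  have b3 : |(∫ x in frontier D, inner ℝ e (H x) ∂σ) - ∫ x in frontier D, inner ℝ (H x) (ν x) ∂σ| ≤
      ε * M * ∫ x in frontier D, ψ x ∂σ := by
    rw [← integral_sub ie iν, ← integral_const_mul]
    refine abs_integral_le_integral_abs.trans ?_
    exact integral_mono_ae id.abs (iψ.const_mul _)
      ((ae_restrict_iff' isClosed_frontier.measurableSet).2 (.of_forall hpt))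
  have c1 := abs_le.1 b1
  have c2 := abs_le.1 b2
  have c3 := abs_le.1 b3
  exact abs_le.2 ⟨by linarith, by linarith⟩

end FlatChart

/-! ### Fields that are only continuous up to the boundary: inward shift. -/

theorem OrthonormalBasis.sum_inner_fderiv_smul {E : Type*} [NormedAddCommGroup E]
    [InnerProductSpace ℝ E] {ι : Type*} [Fintype ι] (b : OrthonormalBasis ι ℝ E) {g : E → ℝ}
    {V : E → E} {g' : E →L[ℝ] ℝ} {V' : E →L[ℝ] E} {x : E} (hg : HasFDerivAt g g' x)
    (hV : HasFDerivAt V V' x) :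
    ∑ i, inner ℝ (b i) (fderiv ℝ (fun y => g y • V y) x (b i)) =
      g x * ∑ i, inner ℝ (b i) (V' (b i)) + g' (V x) := by
  have hprod : HasFDerivAt (fun y => g y • V y) (g x • V' + g'.smulRight (V x)) x := hg.smul hV
  rw [hprod.fderiv]
  simp only [_root_.add_apply, _root_.smul_apply, ContinuousLinearMap.smulRight_apply,
    inner_add_right, inner_smul_right, Finset.sum_add_distrib, ← Finset.mul_sum]
  congr 1
  conv_rhs => rw [← b.sum_repr (V x), map_sum]
  refine Finset.sum_congr rfl fun i _ => ?_
  rw [map_smul, smul_eq_mul, b.repr_apply_apply, mul_comm]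

namespace FlatChart

open Metric Set Filter Topology

variable {E : Type*} [NormedAddCommGroup E] [InnerProductSpace ℝ E] {D : Set E} {p e : E}
  {r ε : ℝ} {φ : E → ℝ}

/-- Moving by `-s • e` strictly decreases `φ`, so a small shift takes the closure of `D` into `D`,
uniformly over a compact part of the ball. -/
theorem eventually_shift_mem (h : FlatChart D p e r ε φ) {K : Set E} (hK : IsCompact K)
    (hKb : K ⊆ ball p r) :
    ∀ᶠ s : ℝ in 𝓝[>] 0, ∀ x ∈ closure D, x ∈ K → x - s • e ∈ D := by
  obtain ⟨δ, hδ, hthick⟩ := hK.exists_thickening_subset_open isOpen_ball hKb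
  filter_upwards [Ioo_mem_nhdsGT hδ] with s hs x hx hxK
  refine h.sub_smul_mem (hKb hxK) hx hs.1 (hthick ?_)
  rw [mem_thickening_iff]
  refine ⟨x, hxK, ?_⟩
  rw [dist_eq_norm, sub_sub_cancel_left, norm_neg, norm_smul, Real.norm_of_nonneg hs.1.le,
    h.norm_eq, mul_one]
  exact hs.2

theorem tendsto_shift {F : E → E} (h : FlatChart D p e r ε φ)
    (hF : ContinuousOn F (closure D)) {x : E} (hx : x ∈ closure D) (hxb : x ∈ ball p r) :
    Tendsto (fun s : ℝ => F (x - s • e)) (𝓝[>] 0) (𝓝 (F x)) := by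
  refine (hF x hx).tendsto.comp (tendsto_nhdsWithin_iff.2 ⟨?_, ?_⟩)
  · have : Continuous (fun s : ℝ => x - s • e) := by fun_prop
    simpa using (this.tendsto 0).mono_left nhdsWithin_le_nhds
  · filter_upwards [h.eventually_shift_mem (isCompact_singleton (x := x))
      (singleton_subset_iff.2 hxb)] with s hs
    exact subset_closure (hs x hx rfl)

variable [FiniteDimensional ℝ E]

/-- A field which is continuously differentiable in `D` is replaced by a smooth field by a shift. -/
theorem exists_shifted_field {F : E → E} (hDo : IsOpen D) {ι : Type*} [Fintype ι]
    (b : OrthonormalBasis ι ℝ E) (hF : ContDiffOn ℝ 1 F D)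
    (hdiv : ∀ x ∈ D, ∑ i, inner ℝ (b i) (fderiv ℝ F x (b i)) = 0) {M : ℝ}
    (hM : ∀ x, ‖F x‖ ≤ M) {ψ : E → ℝ} (hψ : ContDiff ℝ 1 ψ)
    (hψ0 : ∀ x, 0 ≤ ψ x) {a : E} (ha : ∀ x ∈ closure D, x ∈ tsupport ψ → x - a ∈ D) :
    ∃ H : E → E, ContDiff ℝ 1 H ∧ (∀ x, ‖H x‖ ≤ M * ψ x) ∧
      (∀ x ∈ closure D, H x = ψ x • F (x - a)) ∧
      ∀ x ∈ D, ∑ i, inner ℝ (b i) (fderiv ℝ H x (b i)) = fderiv ℝ ψ x (F (x - a)) := by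
  set W : Set E := (fun x => x - a) ⁻¹' D with hW
  have hWo : IsOpen W := hDo.preimage (by fun_prop)
  have hKc : IsClosed (closure D ∩ tsupport ψ) := isClosed_closure.inter (isClosed_tsupport _)
  -- The cutoff vanishes near the points where the shifted field may fail to be `C¹` and equals 1
  -- near the part of the closure of `D` that matters, so the product with it is `C¹` everywhere.
  obtain ⟨χ, hχ0, hχ1, hχI⟩ := exists_contMDiffMap_zero_one_nhds_of_isClosed
    (n := 1) (modelWithCornersSelf ℝ E) hWo.isClosed_compl hKc
    (disjoint_compl_left_iff_subset.2 fun x hx => ha x hx.1 hx.2)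
  have hχ : ContDiff ℝ 1 χ := χ.contMDiff.contDiff
  have hχ0' : ∀ x ∉ W, ∀ᶠ y in 𝓝 x, χ y = 0 := fun x hx =>
    eventually_nhdsSet_iff_forall.1 hχ0 x hx
  have hχ1' : ∀ x ∈ closure D, x ∈ tsupport ψ → ∀ᶠ y in 𝓝 x, χ y = 1 := fun x hx hxs =>
    eventually_nhdsSet_iff_forall.1 hχ1 x ⟨hx, hxs⟩
  refine ⟨fun x => (χ x * ψ x) • F (x - a), ?_, ?_, ?_, ?_⟩
  · refine contDiff_iff_contDiffAt.2 fun x => ?_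
    by_cases hx : x ∈ W
    · have h1 : ContDiffAt ℝ 1 F (x - a) := hF.contDiffAt (hDo.mem_nhds hx)
      have h2 : ContDiffAt ℝ 1 (fun x => F (x - a)) x :=
        h1.comp x (contDiffAt_id.sub contDiffAt_const)
      exact (hχ.mul hψ).contDiffAt.smul h2
    · refine (contDiffAt_const (c := (0 : E))).congr_of_eventuallyEq ?_
      filter_upwards [hχ0' x hx] with y hy
      rw [hy, zero_mul, zero_smul]
  · intro x
    rw [norm_smul, mul_comm, Real.norm_of_nonneg (mul_nonneg (hχI x).1 (hψ0 x))]
    exact mul_le_mul (hM _) (mul_le_of_le_one_left (hψ0 x) (hχI x).2)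
      (mul_nonneg (hχI x).1 (hψ0 x)) ((norm_nonneg _).trans (hM x))
  · intro x hx
    by_cases hxs : x ∈ tsupport ψ
    · simp only [(hχ1' x hx hxs).self_of_nhds, one_mul]
    · simp only [image_eq_zero_of_notMem_tsupport hxs, mul_zero]
  · intro x hx
    by_cases hxs : x ∈ tsupport ψ
    · have hxD := ha x (subset_closure hx) hxs
      have hFd : HasFDerivAt F (fderiv ℝ F (x - a)) (x - a) :=
        ((hF.contDiffAt (hDo.mem_nhds hxD)).differentiableAt (by norm_num)).hasFDerivAt
      have hFs : HasFDerivAt (fun y => F (y - a)) (fderiv ℝ F (x - a)) x := by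
        have := hFd.comp x ((hasFDerivAt_id x).sub_const a)
        simpa [Function.comp_def] using this
      have heq : (fun x => (χ x * ψ x) • F (x - a)) =ᶠ[𝓝 x] fun y => ψ y • F (y - a) := by
        filter_upwards [hχ1' x (subset_closure hx) hxs] with y hy
        rw [hy, one_mul]
      rw [heq.fderiv_eq,
        b.sum_inner_fderiv_smul (hψ.differentiable (by norm_num) x).hasFDerivAt hFs, hdiv _ hxD,
        mul_zero, zero_add]
    · have heq : (fun x => (χ x * ψ x) • F (x - a)) =ᶠ[𝓝 x] fun _ => 0 := by
        filter_upwards [(notMem_tsupport_iff_eventuallyEq.1 hxs)] with y hy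
        rw [hy, Pi.zero_apply, mul_zero, zero_smul]
      rw [heq.fderiv_eq, fderiv_of_notMem_tsupport ℝ hxs]
      simp

variable [MeasurableSpace E] [BorelSpace E]

/-- The divergence theorem in a chart for fields which are continuous up to the boundary, up to an
error controlled by `ε`. -/
theorem abs_integral_fderiv_field_sub_le (h : FlatChart D p e r ε φ) (hDo : IsOpen D)
    (hDb : Bornology.IsBounded D) {σ : Measure E}
    (hσ : σ = Measure.euclideanHausdorffMeasure (Module.finrank ℝ E - 1))
    [IsFiniteMeasure (σ.restrict (frontier D))] {ι : Type*} [Fintype ι]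
    (b : OrthonormalBasis ι ℝ E) {ν : E → E} (hν : ContinuousOn ν (frontier D))
    (hνe : ∀ y ∈ ball p r ∩ frontier D, ‖ν y - e‖ ≤ ε) {F : E → E} {ψ : E → ℝ} {M : ℝ}
    (hFm : Measurable F) (hM : ∀ x, ‖F x‖ ≤ M) (hFc : ContinuousOn F (closure D))
    (hF : ContDiffOn ℝ 1 F D) (hdiv : ∀ x ∈ D, ∑ i, inner ℝ (b i) (fderiv ℝ F x (b i)) = 0)
    (hψ : ContDiff ℝ 1 ψ) (hc : HasCompactSupport ψ)
    (hsupp : tsupport ψ ⊆ ball p r) (hψ0 : ∀ x, 0 ≤ ψ x) :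
    |(∫ x in D, fderiv ℝ ψ x (F x)) - ∫ x in frontier D, ψ x * inner ℝ (F x) (ν x) ∂σ| ≤
      (2 * ε * Fintype.card ι + (((1 - ε)⁻¹) ^ (Module.finrank ℝ E - 1) - 1) + ε) * M *
        ∫ x in frontier D, ψ x ∂σ := by
  have hM0 : 0 ≤ M := (norm_nonneg _).trans (hM 0)
  have hfin : IsFiniteMeasure (volume.restrict D) := ⟨by
    rw [Measure.restrict_apply_univ]; exact hDb.measure_lt_top⟩
  have hFshift : ∀ s : ℝ, Measurable fun x => F (x - s • e) := fun s =>
    hFm.comp (measurable_id.sub_const _)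
  -- The estimate holds for every small shift with a bound independent of `s`, since the divergence
  -- of the localized shifted field is just `∇ψ` applied to it; it then passes to the limit by
  -- dominated convergence.
  have hest : ∀ᶠ s : ℝ in 𝓝[>] 0, |(∫ x in D, fderiv ℝ ψ x (F (x - s • e)))
      - ∫ x in frontier D, ψ x * inner ℝ (F (x - s • e)) (ν x) ∂σ| ≤
      (2 * ε * Fintype.card ι + (((1 - ε)⁻¹) ^ (Module.finrank ℝ E - 1) - 1) + ε) * M *
        ∫ x in frontier D, ψ x ∂σ := by
    filter_upwards [h.eventually_shift_mem hc hsupp] with s hs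
    obtain ⟨H, hH, hHle, hHf, hHd⟩ :=
      exists_shifted_field hDo b hF hdiv hM hψ hψ0 (a := s • e) hs
    have := h.abs_integral_divergence_sub_le hDo hDb hσ b hν hνe hM0 hH hψ hc hsupp hψ0 hHle
    rw [setIntegral_congr_fun hDo.measurableSet hHd,
      setIntegral_congr_fun (g := fun x => ψ x * inner ℝ (F (x - s • e)) (ν x))
        isClosed_frontier.measurableSet
        fun x hx => by
          simp only [hHf x (frontier_subset_closure hx), real_inner_smul_left]] at this
    exact this
  refine le_of_tendsto (Tendsto.abs (Tendsto.sub ?_ ?_)) hest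
  · obtain ⟨C, hC⟩ := hψ.exists_norm_fderiv_le hc
    refine tendsto_integral_filter_of_dominated_convergence (fun _ => C * M) ?_ ?_
      (integrable_const _) ?_
    · refine .of_forall fun s => ?_
      have hb : Measurable fun q : (E →L[ℝ] ℝ) × E => q.1 q.2 := by
        have : Continuous fun q : (E →L[ℝ] ℝ) × E => q.1 q.2 := by fun_prop
        exact this.measurable
      exact (hb.comp ((hψ.continuous_fderiv (by norm_num)).measurable.prodMk
        (hFshift s))).aestronglyMeasurable
    · exact .of_forall fun s => .of_forall fun x => ((fderiv ℝ ψ x).le_opNorm _).trans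
        (mul_le_mul (hC x) (hM _) (norm_nonneg _) ((norm_nonneg _).trans (hC x)))
    · refine (ae_restrict_iff' hDo.measurableSet).2 (.of_forall fun x hx => ?_)
      by_cases hxs : x ∈ tsupport ψ
      · exact ((fderiv ℝ ψ x).continuous.tendsto _).comp
          (h.tendsto_shift hFc (subset_closure hx) (hsupp hxs))
      · rw [fderiv_of_notMem_tsupport ℝ hxs]
        simp
  · have hνm := hν.aestronglyMeasurable (μ := σ) isClosed_frontier.measurableSet
    have iψ : Integrable ψ (σ.restrict (frontier D)) :=
      hψ.continuous.integrable_of_hasCompactSupport hc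
    refine tendsto_integral_filter_of_dominated_convergence (fun x => M * (1 + ε) * ψ x) ?_ ?_
      (iψ.const_mul _) ?_
    · exact .of_forall fun s => iψ.1.mul ((hFshift s).aestronglyMeasurable.inner hνm)
    · refine .of_forall fun s => (ae_restrict_iff' isClosed_frontier.measurableSet).2
        (.of_forall fun x hx => ?_)
      by_cases hxs : x ∈ tsupport ψ
      · have h1 : ‖ν x‖ ≤ 1 + ε := by
          have h2 := norm_add_le e (ν x - e)
          rw [add_sub_cancel, h.norm_eq] at h2
          linarith [hνe x ⟨hsupp hxs, hx⟩]
        rw [norm_mul, Real.norm_of_nonneg (hψ0 x), mul_comm]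
        refine mul_le_mul_of_nonneg_right ((norm_inner_le_norm _ _).trans ?_) (hψ0 x)
        exact mul_le_mul (hM _) h1 (norm_nonneg _) hM0
      · rw [image_eq_zero_of_notMem_tsupport hxs]
        simp
    · refine (ae_restrict_iff' isClosed_frontier.measurableSet).2 (.of_forall fun x hx => ?_)
      by_cases hxs : x ∈ tsupport ψ
      · exact ((h.tendsto_shift hFc (frontier_subset_closure hx) (hsupp hxs)).inner
          tendsto_const_nhds).const_mul _
      · rw [image_eq_zero_of_notMem_tsupport hxs]
        simp

end FlatChart

/-! ### The global divergence theorem by a partition of unity. -/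

theorem integral_fderiv_apply_eq_zero {E : Type*} [NormedAddCommGroup E] [InnerProductSpace ℝ E]
    [FiniteDimensional ℝ E] [MeasurableSpace E] [BorelSpace E] {f : E → ℝ} (hf : ContDiff ℝ 1 f)
    (hc : HasCompactSupport f) {e : E} (he : ‖e‖ = 1) : ∫ x, fderiv ℝ f x e = 0 := by
  rw [(integral_eq_integral_integral_line he (hf.integrable_fderiv_apply hc e)).2]
  simp only [← deriv_line hf, (hasCompactSupport_line hc he _).integral_deriv_eq_zero
    (contDiff_line hf e _), integral_zero]

namespace IsC2Domain

open Metric Set Filter Topology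

variable {d : ℕ} {D : Set (EuclideanSpace ℝ (Fin d))}

/-- A piece of boundary in a flat chart has finite measure, and finitely many such pieces suffice by
compactness. -/
theorem isFiniteMeasure_surfaceMeasure (hD : IsC2Domain D) :
    IsFiniteMeasure (surfaceMeasure D) := by
  refine ⟨?_⟩
  rw [surfaceMeasure, Measure.restrict_apply_univ]
  refine hD.isCompact_frontier.measure_lt_top_of_nhdsWithin fun p hp => ?_
  obtain ⟨r, φ, h, -⟩ := hD.exists_flatChart hp (ε := 1 / 2) (by norm_num) le_rfl
  have := h.measure_frontier_lt_top hD.isOpen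
  rw [finrank_euclideanSpace_fin] at this
  exact ⟨_, inter_mem_nhdsWithin _ (ball_mem_nhds p h.radius_pos), this⟩

theorem integrable_of_continuousOn (hD : IsC2Domain D) {g : EuclideanSpace ℝ (Fin d) → ℝ}
    (hg : ContinuousOn g (frontier D)) : Integrable g (surfaceMeasure D) := by
  have := hD.isFiniteMeasure_surfaceMeasure
  have h := hg.integrableOn_compact (μ := surfaceMeasure D) hD.isCompact_frontier
  rwa [IntegrableOn, surfaceMeasure, Measure.restrict_restrict isClosed_frontier.measurableSet,
    inter_self] at h

/-- The interior case: `ψF` is `C¹` with compact support in `D`, its divergence is `∇ψ · F`, and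
derivatives of compactly supported functions integrate to zero. -/
theorem integral_fderiv_field_eq_zero (hD : IsC2Domain D)
    {F : EuclideanSpace ℝ (Fin d) → EuclideanSpace ℝ (Fin d)} {M : ℝ} (hM : ∀ x, ‖F x‖ ≤ M)
    (hF : ContDiffOn ℝ 1 F D)
    (hdiv : ∀ x ∈ D, ∑ i, inner ℝ (EuclideanSpace.basisFun (Fin d) ℝ i)
      (fderiv ℝ F x (EuclideanSpace.basisFun (Fin d) ℝ i)) = 0)
    {ψ : EuclideanSpace ℝ (Fin d) → ℝ} (hψ : ContDiff ℝ 1 ψ) (hψ0 : ∀ x, 0 ≤ ψ x)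
    (hsupp : tsupport ψ ⊆ D) : ∫ x in D, fderiv ℝ ψ x (F x) = 0 := by
  obtain ⟨H, hH, hHle, -, hHd⟩ := FlatChart.exists_shifted_field hD.isOpen
    (EuclideanSpace.basisFun (Fin d) ℝ) hF hdiv hM hψ hψ0 (a := 0)
    (fun x _ hx => by rw [sub_zero]; exact hsupp hx)
  simp only [sub_zero] at hHd
  have hHs : tsupport H ⊆ tsupport ψ := closure_mono fun x hx hx0 => hx (by
    have := hHle x; rw [hx0, mul_zero] at this; exact norm_le_zero_iff.1 this)
  have hHc : HasCompactSupport H := hD.isCompact_closure.of_isClosed_subset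
    (isClosed_tsupport _) ((hHs.trans hsupp).trans subset_closure)
  rw [← setIntegral_congr_fun hD.isOpen.measurableSet hHd,
    setIntegral_eq_integral_of_forall_compl_eq_zero fun x hx => by
      rw [fderiv_of_notMem_tsupport ℝ fun hm => hx (hsupp (hHs hm))]; simp]
  have hcomp : ∀ v, ContDiff ℝ 1 fun x => inner ℝ v (H x) := fun v => contDiff_const.inner ℝ hH
  have hcompc : ∀ v, HasCompactSupport fun x => inner ℝ v (H x) := fun v =>
    hHc.mono fun x hx hx0 => hx (by simp only [hx0, inner_zero_right])
  have hcompd : ∀ v x w, inner ℝ v (fderiv ℝ H x w) = fderiv ℝ (fun x => inner ℝ v (H x)) x w := by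
    intro v x w
    have : HasFDerivAt (fun x => inner ℝ v (H x)) ((innerSL ℝ v).comp (fderiv ℝ H x)) x :=
      (innerSL ℝ v).hasFDerivAt.comp x (hH.differentiable (by norm_num) x).hasFDerivAt
    rw [this.fderiv]
    rfl
  simp only [hcompd]
  rw [integral_finsetSum _ fun i _ => (hcomp _).integrable_fderiv_apply (hcompc _) _]
  exact Finset.sum_eq_zero fun i _ => integral_fderiv_apply_eq_zero (hcomp _) (hcompc _)
    (OrthonormalBasis.norm_eq_one _ i)

/-- The number and size of the charts depend on ε without control, but the bound does not see them:
the partition functions sum to 1 on the boundary. -/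
theorem abs_flux_le (hD : IsC2Domain D)
    {F : EuclideanSpace ℝ (Fin d) → EuclideanSpace ℝ (Fin d)} {M : ℝ}
    (hFm : Measurable F) (hM : ∀ x, ‖F x‖ ≤ M) (hFc : ContinuousOn F (closure D))
    (hF : ContDiffOn ℝ 1 F D)
    (hdiv : ∀ x ∈ D, ∑ i, inner ℝ (EuclideanSpace.basisFun (Fin d) ℝ i)
      (fderiv ℝ F x (EuclideanSpace.basisFun (Fin d) ℝ i)) = 0)
    {ε : ℝ} (hε : 0 < ε) (hε' : ε ≤ 1 / 2) :
    |∫ y, inner ℝ (F y) (outwardNormal D y) ∂(surfaceMeasure D)| ≤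
      (2 * ε * d + (((1 - ε)⁻¹) ^ (d - 1) - 1) + ε) * M * (surfaceMeasure D).real univ := by
  have hfin := hD.isFiniteMeasure_surfaceMeasure
  have hM0 : 0 ≤ M := (norm_nonneg _).trans (hM 0)
  set C := 2 * ε * d + (((1 - ε)⁻¹) ^ (d - 1) - 1) + ε with hC
  have hC0 : 0 ≤ C := by
    have : 1 ≤ ((1 - ε)⁻¹) ^ (d - 1) :=
      one_le_pow₀ ((one_le_inv₀ (by linarith)).2 (by linarith))
    have h2 : 0 ≤ 2 * ε * d := by positivity
    linarith
  choose! r φ hch hν using fun p (hp : p ∈ frontier D) => hD.exists_flatChart hp hε hε'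
  obtain ⟨t, htf, htc⟩ := hD.isCompact_frontier.elim_nhds_subcover (fun p => ball p (r p))
    fun p hp => ball_mem_nhds p (hch p hp).radius_pos
  -- The index `none` stands for the interior piece `D`, the others for chart balls around boundary
  -- points.
  let U : Option t → Set (EuclideanSpace ℝ (Fin d)) := fun i => i.elim D fun p => ball p.1 (r p)
  have hUo : ∀ i, IsOpen (U i) := by
    rintro (_ | p)
    · exact hD.isOpen
    · exact isOpen_ball
  have hUc : closure D ⊆ ⋃ i, U i := by
    intro x hx
    by_cases hxD : x ∈ D
    · exact mem_iUnion.2 ⟨none, hxD⟩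
    · have hxf : x ∈ frontier D := by rw [hD.isOpen.frontier_eq]; exact ⟨hx, hxD⟩
      obtain ⟨p, hp, hxp⟩ := mem_iUnion₂.1 (htc hxf)
      exact mem_iUnion.2 ⟨some ⟨p, hp⟩, hxp⟩
  obtain ⟨f, hf⟩ := SmoothPartitionOfUnity.exists_isSubordinate
    (modelWithCornersSelf ℝ (EuclideanSpace ℝ (Fin d))) isClosed_closure U hUo hUc
  have hsm : ∀ i, ContDiff ℝ 1 (f i) := fun i => (f i).contMDiff.contDiff.of_le (by
    exact_mod_cast le_top)
  have hsum : ∀ x ∈ closure D, ∑ i, f i x = 1 := fun x hx => by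
    rw [← finsum_eq_sum_of_fintype]; exact f.sum_eq_one hx
  have hint : ∀ g : EuclideanSpace ℝ (Fin d) → ℝ, ContinuousOn g (frontier D) →
      Integrable g (surfaceMeasure D) := fun g => hD.integrable_of_continuousOn
  have hae : ∀ {P : EuclideanSpace ℝ (Fin d) → Prop}, (∀ x ∈ frontier D, P x) →
      ∀ᵐ x ∂(surfaceMeasure D), P x := fun hP =>
    (ae_restrict_iff' isClosed_frontier.measurableSet).2 (.of_forall hP)
  have hFn : ContinuousOn (fun y => inner ℝ (F y) (outwardNormal D y)) (frontier D) :=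
    (hFc.mono frontier_subset_closure).inner hD.continuousOn_outwardNormal
  have hbnd : ∀ i, |(∫ x in D, fderiv ℝ (f i) x (F x))
      - ∫ x, f i x * inner ℝ (F x) (outwardNormal D x) ∂(surfaceMeasure D)| ≤
      C * M * ∫ x, f i x ∂(surfaceMeasure D) := by
    rintro (_ | p)
    · have hs : tsupport (f none) ⊆ D := hf none
      rw [hD.integral_fderiv_field_eq_zero hM hF hdiv (hsm none) (f.nonneg none) hs, zero_sub,
        abs_neg, integral_eq_zero_of_ae, abs_zero]
      · exact mul_nonneg (mul_nonneg hC0 hM0) (integral_nonneg (f.nonneg none))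
      · refine hae fun x hx => ?_
        rw [hD.isOpen.frontier_eq] at hx
        have h0 : f none x = 0 := image_eq_zero_of_notMem_tsupport fun hm => hx.2 (hs hm)
        simp only [h0, zero_mul, Pi.zero_apply]
    · have hp := htf p p.2
      have hs : tsupport (f (some p)) ⊆ ball p.1 (r p) := hf (some p)
      have hc : HasCompactSupport (f (some p)) :=
        (isCompact_closedBall p.1 (r p)).of_isClosed_subset (isClosed_tsupport _)
          (hs.trans ball_subset_closedBall)
      have : IsFiniteMeasure ((Measure.euclideanHausdorffMeasure (d - 1) :
        Measure (EuclideanSpace ℝ (Fin d))).restrict (frontier D)) := hfin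
      have key := (hch p hp).abs_integral_fderiv_field_sub_le hD.isOpen hD.isBounded
        (σ := Measure.euclideanHausdorffMeasure (d - 1))
        (by rw [finrank_euclideanSpace_fin]) (EuclideanSpace.basisFun (Fin d) ℝ)
        hD.continuousOn_outwardNormal (hν p hp) hFm hM hFc hF hdiv (hsm (some p)) hc hs
        (f.nonneg (some p))
      rwa [finrank_euclideanSpace_fin, Fintype.card_fin] at key
  -- The partition functions sum to 1 near each point of `D`, so their derivatives there sum to zero
  -- and the volume terms cancel.
  have hA : ∑ i, ∫ x in D, fderiv ℝ (f i) x (F x) = 0 := by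
    have hi : ∀ i, Integrable (fun x => fderiv ℝ (f i) x (F x)) (volume.restrict D) := by
      intro i
      have hc : ContinuousOn (fun x => fderiv ℝ (f i) x (F x)) (closure D) :=
        ((hsm i).continuous_fderiv (by norm_num)).continuousOn.clm_apply hFc
      exact (hc.integrableOn_compact hD.isCompact_closure).mono_set subset_closure
    rw [← integral_finsetSum _ fun i _ => hi i]
    refine setIntegral_eq_zero_of_forall_eq_zero fun x hx => ?_
    have h1 : HasFDerivAt (fun x => ∑ i, f i x) (∑ i, fderiv ℝ (f i) x) x :=
      HasFDerivAt.fun_sum fun i _ => ((hsm i).differentiable (by norm_num) x).hasFDerivAt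
    have h2 : (fun x => ∑ i, f i x) =ᶠ[𝓝 x] fun _ => 1 := by
      filter_upwards [hD.isOpen.mem_nhds hx] with y hy using hsum y (subset_closure hy)
    have h3 : ∑ i, fderiv ℝ (f i) x = 0 :=
      h1.unique ((hasFDerivAt_const (1 : ℝ) x).congr_of_eventuallyEq h2)
    rw [← _root_.sum_apply, h3, _root_.zero_apply]
  have hfc : ∀ i, ContinuousOn (f i) (frontier D) := fun i => (hsm i).continuous.continuousOn
  have hB : ∑ i, ∫ x, f i x * inner ℝ (F x) (outwardNormal D x) ∂(surfaceMeasure D) =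
      ∫ x, inner ℝ (F x) (outwardNormal D x) ∂(surfaceMeasure D) := by
    have hi : ∀ i, Integrable (fun x => f i x * inner ℝ (F x) (outwardNormal D x))
        (surfaceMeasure D) := fun i => hint _ ((hfc i).mul hFn)
    rw [← integral_finsetSum _ fun i _ => hi i]
    refine integral_congr_ae (hae fun x hx => ?_)
    simp only [← Finset.sum_mul, hsum x (frontier_subset_closure hx), one_mul]
  have hS : ∑ i, ∫ x, f i x ∂(surfaceMeasure D) = (surfaceMeasure D).real univ := by
    rw [← integral_finsetSum _ fun i _ => hint _ (hfc i)]
    rw [integral_congr_ae (g := fun _ => (1 : ℝ))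
      (hae fun x hx => hsum x (frontier_subset_closure hx))]
    simp
  rw [← hB, ← hS, Finset.mul_sum, ← abs_neg, ← zero_sub, ← hA, ← Finset.sum_sub_distrib]
  exact (Finset.abs_sum_le_sum_abs _ _).trans (Finset.sum_le_sum fun i _ => hbnd i)

/-- The flux of a divergence free field, continuous up to the boundary, is zero. -/
theorem integral_inner_outwardNormal_eq_zero (hD : IsC2Domain D)
    {F : EuclideanSpace ℝ (Fin d) → EuclideanSpace ℝ (Fin d)} (hFc : ContinuousOn F (closure D))
    (hF : ContDiffOn ℝ 1 F D)
    (hdiv : ∀ x ∈ D, ∑ i, inner ℝ (EuclideanSpace.basisFun (Fin d) ℝ i)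
      (fderiv ℝ F x (EuclideanSpace.basisFun (Fin d) ℝ i)) = 0) :
    ∫ y, inner ℝ (F y) (outwardNormal D y) ∂(surfaceMeasure D) = 0 := by
  classical
  obtain ⟨M, hM⟩ := hD.isCompact_closure.exists_bound_of_continuousOn hFc
  -- The extension by zero is measurable and bounded on the whole space; only its values on the
  -- closure of `D` enter the flux.
  set F' := (closure D).indicator F with hF'
  have hEq : ∀ x ∈ closure D, F' x = F x := fun x hx => indicator_of_mem hx _
  have hev : ∀ x ∈ D, F' =ᶠ[𝓝 x] F := fun x hx => by
    filter_upwards [hD.isOpen.mem_nhds hx] with y hy using hEq y (subset_closure hy)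
  have hm : Measurable F' := by
    have := hFc.measurable_piecewise (g := 0) continuousOn_const
      isClosed_closure.measurableSet
    rwa [piecewise_eq_indicator] at this
  have hbd : ∀ x, ‖F' x‖ ≤ max M 0 := fun x => by
    by_cases hx : x ∈ closure D
    · rw [hEq x hx]; exact (hM x hx).trans (le_max_left _ _)
    · rw [hF', indicator_of_notMem hx, norm_zero]; exact le_max_right _ _
  have hle : ∀ᶠ ε : ℝ in 𝓝[>] 0, |∫ y, inner ℝ (F' y) (outwardNormal D y) ∂(surfaceMeasure D)| ≤
      (2 * ε * d + (((1 - ε)⁻¹) ^ (d - 1) - 1) + ε) * max M 0 * (surfaceMeasure D).real univ := by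
    filter_upwards [Ioc_mem_nhdsGT (show (0 : ℝ) < 1 / 2 by norm_num)] with ε hε
    refine hD.abs_flux_le hm hbd (hFc.congr hEq) (hF.congr fun x hx => hEq x (subset_closure hx))
      (fun x hx => ?_) hε.1 hε.2
    rw [(hev x hx).fderiv_eq]
    exact hdiv x hx
  have hlim : Tendsto (fun ε : ℝ => (2 * ε * d + (((1 - ε)⁻¹) ^ (d - 1) - 1) + ε) * max M 0 *
      (surfaceMeasure D).real univ) (𝓝[>] 0) (𝓝 0) := by
    have : ContinuousAt (fun ε : ℝ => (2 * ε * d + (((1 - ε)⁻¹) ^ (d - 1) - 1) + ε) * max M 0 *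
        (surfaceMeasure D).real univ) 0 := by
      have h1 : ContinuousAt (fun ε : ℝ => (1 - ε)⁻¹) 0 :=
        (continuousAt_const.sub continuousAt_id).inv₀ (by norm_num)
      fun_prop
    simpa using this.tendsto.mono_left nhdsWithin_le_nhds
  have h0 := abs_nonpos_iff.1 (ge_of_tendsto hlim hle)
  rw [← h0]
  refine integral_congr_ae ((ae_restrict_iff' isClosed_frontier.measurableSet).2
    (.of_forall fun x hx => ?_))
  simp only [hEq x (frontier_subset_closure hx)]

end IsC2Domain

/-! ### The fundamental solution: gradient and harmonicity away from the pole. -/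

section Kernel

theorem hasFDerivAt_norm_of_ne {E : Type*} [NormedAddCommGroup E] [InnerProductSpace ℝ E] {z : E}
    (hz : z ≠ 0) : HasFDerivAt (fun z : E => ‖z‖) (‖z‖⁻¹ • innerSL ℝ z) z := by
  have h := ((hasStrictFDerivAt_norm_sq z).hasFDerivAt).sqrt (by simpa using hz)
  simp only [Real.sqrt_sq (norm_nonneg _)] at h
  refine h.congr_fderiv ?_
  ext w
  simp only [_root_.smul_apply, smul_eq_mul, nsmul_eq_mul]
  push_cast
  ring

/-- The field `z / ‖z‖ ^ d` is divergence free. -/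
theorem exists_hasFDerivAt_inv_norm_pow_smul {d : ℕ} (hd : d ≠ 0) {z : EuclideanSpace ℝ (Fin d)}
    (hz : z ≠ 0) : ∃ L : EuclideanSpace ℝ (Fin d) →L[ℝ] EuclideanSpace ℝ (Fin d),
      HasFDerivAt (fun z : EuclideanSpace ℝ (Fin d) => (‖z‖ ^ d)⁻¹ • z) L z ∧
      ∑ i, inner ℝ (EuclideanSpace.basisFun (Fin d) ℝ i)
        (L (EuclideanSpace.basisFun (Fin d) ℝ i)) = 0 := by
  have hn : ‖z‖ ≠ 0 := norm_ne_zero_iff.2 hz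
  have h1 : HasDerivAt (fun t : ℝ => (t ^ d)⁻¹) (-(d * ‖z‖ ^ (d - 1)) / (‖z‖ ^ d) ^ 2) ‖z‖ :=
    (hasDerivAt_pow d ‖z‖).inv (pow_ne_zero _ hn)
  have h2 : HasFDerivAt (fun z : EuclideanSpace ℝ (Fin d) => (‖z‖ ^ d)⁻¹)
      ((-(d * ‖z‖ ^ (d - 1)) / (‖z‖ ^ d) ^ 2) • ‖z‖⁻¹ • innerSL ℝ z) z :=
    h1.comp_hasFDerivAt z (hasFDerivAt_norm_of_ne hz)
  have h3 : DifferentiableAt ℝ (fun z : EuclideanSpace ℝ (Fin d) => (‖z‖ ^ d)⁻¹ • z) z :=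
    (h2.smul (hasFDerivAt_id (𝕜 := ℝ) z)).differentiableAt
  refine ⟨_, h3.hasFDerivAt, ?_⟩
  -- The divergence is `d‖z‖⁻ᵈ`, from the divergence `d` of the identity field, plus the radial
  -- derivative term, which is `-d‖z‖⁻ᵈ`.
  refine ((EuclideanSpace.basisFun (Fin d) ℝ).sum_inner_fderiv_smul h2 (hasFDerivAt_id z)).trans ?_
  simp only [ContinuousLinearMap.id_apply, id_eq, _root_.smul_apply, smul_eq_mul,
    innerSL_apply_apply, real_inner_self_eq_norm_sq, OrthonormalBasis.norm_eq_one]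
  have h4 : ‖z‖ ^ (d - 1) = ‖z‖ ^ d / ‖z‖ := by
    rw [eq_div_iff hn, pow_sub_one_mul hd]
  rw [h4]
  simp only [one_pow, Finset.sum_const, Finset.card_univ, Fintype.card_fin, nsmul_eq_mul, mul_one]
  field_simp
  ring

/-- The gradient of the fundamental solution. -/
noncomputable def laplaceKernelGrad {d : ℕ} (x y : EuclideanSpace ℝ (Fin d)) :
    EuclideanSpace ℝ (Fin d) :=
  -(if d = 2 then 1 / (2 * Real.pi) else 1 / (4 * Real.pi)) • (‖y - x‖ ^ d)⁻¹ • (y - x)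

variable {d : ℕ} {x y : EuclideanSpace ℝ (Fin d)}

theorem hasFDerivAt_laplaceKernel (hd : d = 2 ∨ d = 3) (hxy : y ≠ x) :
    HasFDerivAt (fun y => laplaceKernel x y) (innerSL ℝ (laplaceKernelGrad x y)) y := by
  have hz : y - x ≠ 0 := sub_ne_zero.2 hxy
  have hn : ‖y - x‖ ≠ 0 := norm_ne_zero_iff.2 hz
  have hN : HasFDerivAt (fun y => ‖y - x‖) (‖y - x‖⁻¹ • innerSL ℝ (y - x)) y := by
    simpa [Function.comp_def] using
      (hasFDerivAt_norm_of_ne hz).comp y ((hasFDerivAt_id y).sub_const x)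
  rcases hd with rfl | rfl
  · have h := (hN.log hn).const_mul (-(1 / (2 * Real.pi)))
    have hfun : (fun y => laplaceKernel x y) = fun y : EuclideanSpace ℝ (Fin 2) =>
        -(1 / (2 * Real.pi)) * Real.log ‖y - x‖ := by
      funext y; simp [laplaceKernel, norm_sub_rev]
    rw [hfun]
    refine h.congr_fderiv ?_
    ext w
    simp only [laplaceKernelGrad, if_true, _root_.smul_apply, smul_eq_mul, innerSL_apply_apply,
      real_inner_smul_left]
    field_simp
  · have h1 : HasDerivAt (fun t : ℝ => 1 / (4 * Real.pi) * (1 / t))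
        (1 / (4 * Real.pi) * -(‖y - x‖ ^ 2)⁻¹) ‖y - x‖ := by
      simpa using (hasDerivAt_inv hn).const_mul (1 / (4 * Real.pi))
    have h := h1.comp_hasFDerivAt y hN
    have hfun : (fun y => laplaceKernel x y) = fun y : EuclideanSpace ℝ (Fin 3) =>
        1 / (4 * Real.pi) * (1 / ‖y - x‖) := by
      funext y; simp [laplaceKernel, norm_sub_rev]
    rw [hfun]
    refine h.congr_fderiv ?_
    ext w
    simp only [laplaceKernelGrad, _root_.smul_apply, smul_eq_mul, innerSL_apply_apply,
      real_inner_smul_left]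
    norm_num
    field_simp

theorem contDiffAt_laplaceKernelGrad (hxy : y ≠ x) :
    ContDiffAt ℝ 1 (fun y => laplaceKernelGrad x y) y := by
  have h1 : ContDiffAt ℝ 1 (fun y => ‖y - x‖) y :=
    (contDiffAt_id.sub contDiffAt_const).norm ℝ (sub_ne_zero.2 hxy)
  have h2 : ContDiffAt ℝ 1 (fun y => (‖y - x‖ ^ d)⁻¹) y :=
    (h1.pow d).inv (pow_ne_zero _ (norm_ne_zero_iff.2 (sub_ne_zero.2 hxy)))
  have h3 : ContDiffAt ℝ 1 (fun y => (‖y - x‖ ^ d)⁻¹ • (y - x)) y :=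
    h2.smul (contDiffAt_id.sub contDiffAt_const)
  exact h3.const_smul (-(if d = 2 then 1 / (2 * Real.pi) else 1 / (4 * Real.pi)) : ℝ)

theorem sum_inner_fderiv_laplaceKernelGrad (hd : d ≠ 0) (hxy : y ≠ x) :
    ∑ i, inner ℝ (EuclideanSpace.basisFun (Fin d) ℝ i)
      (fderiv ℝ (fun y => laplaceKernelGrad x y) y (EuclideanSpace.basisFun (Fin d) ℝ i)) = 0 := by
  obtain ⟨L, hL, hL0⟩ := exists_hasFDerivAt_inv_norm_pow_smul hd (sub_ne_zero.2 hxy)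
  have h1 : HasFDerivAt (fun y => (‖y - x‖ ^ d)⁻¹ • (y - x)) L y := by
    simpa [Function.comp_def] using hL.comp y ((hasFDerivAt_id y).sub_const x)
  refine ((EuclideanSpace.basisFun (Fin d) ℝ).sum_inner_fderiv_smul
    (hasFDerivAt_const _ y) h1).trans ?_
  rw [hL0, mul_zero, zero_add, _root_.zero_apply]

end Kernel

-- Translates harmonicity into the form of the divergence hypothesis of the flux theorem, coordinate
-- by coordinate.
open InnerProductSpace in
theorem sum_inner_fderiv_gradient {d : ℕ} {v : EuclideanSpace ℝ (Fin d) → ℝ}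
    {y : EuclideanSpace ℝ (Fin d)} (hv : ContDiffAt ℝ 2 v y) :
    DifferentiableAt ℝ (∇ v) y ∧ ∑ i, inner ℝ (EuclideanSpace.basisFun (Fin d) ℝ i)
      (fderiv ℝ (∇ v) y (EuclideanSpace.basisFun (Fin d) ℝ i)) = Laplacian.laplacian v y := by
  have h0 : ContDiffAt ℝ 1 (fderiv ℝ v) y := hv.fderiv_right (m := 1) (by norm_num)
  have h1 : HasFDerivAt (fderiv ℝ v) (fderiv ℝ (fderiv ℝ v) y) y :=
    (h0.differentiableAt (by norm_num)).hasFDerivAt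
  have h2 : ContDiffAt ℝ 1 (∇ v) y :=
    (toDual ℝ (EuclideanSpace ℝ (Fin d))).symm.contDiff.contDiffAt.comp y h0
  have h3 := (h2.differentiableAt (by norm_num))
  refine ⟨h3, ?_⟩
  rw [laplacian_eq_iteratedFDeriv_orthonormalBasis v (EuclideanSpace.basisFun (Fin d) ℝ)]
  refine Finset.sum_congr rfl fun i _ => ?_
  set b := EuclideanSpace.basisFun (Fin d) ℝ i
  rw [iteratedFDeriv_two_apply]
  have e1 : HasFDerivAt (fun z => inner ℝ b (∇ v z)) ((innerSL ℝ b).comp (fderiv ℝ (∇ v) y)) y :=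
    (innerSL ℝ b).hasFDerivAt.comp y h3.hasFDerivAt
  have e2 : (fun z => inner ℝ b (∇ v z)) = fun z => fderiv ℝ v z b := by
    funext z
    rw [real_inner_comm]
    exact toDual_symm_apply
  have e3 : HasFDerivAt (fun z => fderiv ℝ v z b) ((fderiv ℝ (fderiv ℝ v) y).flip b) y :=
    (ContinuousLinearMap.apply ℝ ℝ b).hasFDerivAt.comp y h1
  rw [e2] at e1
  exact congrArg (fun L => L b) (e1.unique e3)

/-! ### Green's second identity. -/

namespace IsC2Domain

open Metric Set Filter Topology

variable {d : ℕ} {D : Set (EuclideanSpace ℝ (Fin d))}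

/-- The gradient up to the boundary. -/
noncomputable def gradientOn (D : Set (EuclideanSpace ℝ (Fin d)))
    (v : EuclideanSpace ℝ (Fin d) → ℝ) (y : EuclideanSpace ℝ (Fin d)) :
    EuclideanSpace ℝ (Fin d) :=
  (InnerProductSpace.toDual ℝ (EuclideanSpace ℝ (Fin d))).symm (fderivWithin ℝ v (closure D) y)

theorem inner_gradientOn (v : EuclideanSpace ℝ (Fin d) → ℝ) (y : EuclideanSpace ℝ (Fin d)) :
    inner ℝ (gradientOn D v y) (outwardNormal D y) = normalDeriv D v y :=
  InnerProductSpace.toDual_symm_apply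

theorem continuousOn_gradientOn (hD : IsC2Domain D) {v : EuclideanSpace ℝ (Fin d) → ℝ}
    (hv : ContDiffOn ℝ 1 v (closure D)) : ContinuousOn (gradientOn D v) (closure D) :=
  (InnerProductSpace.toDual ℝ (EuclideanSpace ℝ (Fin d))).symm.continuous.comp_continuousOn
    (hv.continuousOn_fderivWithin hD.uniqueDiffOn_closure (by norm_num))

/-- The one-sided gradient is what is continuous up to the boundary; equality with `∇ v` near
interior points lets its divergence be computed as the Laplacian. -/
theorem gradientOn_eventuallyEq (hD : IsC2Domain D) (v : EuclideanSpace ℝ (Fin d) → ℝ)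
    {y : EuclideanSpace ℝ (Fin d)} (hy : y ∈ D) : gradientOn D v =ᶠ[𝓝 y] ∇ v := by
  filter_upwards [hD.isOpen.mem_nhds hy] with z hz
  rw [gradientOn, fderivWithin_of_mem_nhds (mem_of_superset (hD.isOpen.mem_nhds hz) subset_closure)]
  rfl

theorem normalDeriv_laplaceKernel (hd : d = 2 ∨ d = 3) (hD : IsC2Domain D)
    {x y : EuclideanSpace ℝ (Fin d)} (hxy : y ≠ x) (hy : y ∈ closure D) :
    normalDeriv D (fun z => laplaceKernel x z) y =
      inner ℝ (laplaceKernelGrad x y) (outwardNormal D y) := by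
  rw [normalDeriv, (hasFDerivAt_laplaceKernel hd hxy).hasFDerivWithinAt.fderivWithin
    (hD.uniqueDiffOn_closure y hy), innerSL_apply_apply]

theorem continuousOn_normalDeriv (hD : IsC2Domain D) {v : EuclideanSpace ℝ (Fin d) → ℝ}
    (hv : ContDiffOn ℝ 1 v (closure D)) : ContinuousOn (normalDeriv D v) (frontier D) := by
  have : normalDeriv D v = fun y => inner ℝ (gradientOn D v y) (outwardNormal D y) :=
    funext fun y => (inner_gradientOn v y).symm
  rw [this]
  exact ((hD.continuousOn_gradientOn hv).mono frontier_subset_closure).inner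
    hD.continuousOn_outwardNormal

theorem contDiffOn_laplaceKernel {x : EuclideanSpace ℝ (Fin d)}
    {s : Set (EuclideanSpace ℝ (Fin d))} (hx : x ∉ s) :
    ContDiffOn ℝ 1 (fun y => laplaceKernel x y) s := by
  have hn : ∀ y ∈ s, ContDiffAt ℝ 1 (fun y => ‖x - y‖) y := fun y hy =>
    (contDiffAt_const.sub contDiffAt_id).norm ℝ (sub_ne_zero.2 fun h => hx (h ▸ hy))
  have hne : ∀ y ∈ s, ‖x - y‖ ≠ 0 := fun y hy =>
    norm_ne_zero_iff.2 (sub_ne_zero.2 fun h => hx (h ▸ hy))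
  intro y hy
  apply ContDiffAt.contDiffWithinAt
  unfold laplaceKernel
  split_ifs
  · exact contDiffAt_const.mul ((hn y hy).log (hne y hy))
  · exact contDiffAt_const.mul (contDiffAt_const.div (hn y hy) (hne y hy))

/-- Green's second identity for a harmonic function and the fundamental solution with pole in the
exterior. -/
theorem integral_green (hd : d = 2 ∨ d = 3) (hD : IsC2Domain D) {x : EuclideanSpace ℝ (Fin d)}
    (hx : x ∈ (closure D)ᶜ) {v : EuclideanSpace ℝ (Fin d) → ℝ}
    (hv : InnerProductSpace.HarmonicOnNhd v D) (hv1 : ContDiffOn ℝ 1 v (closure D)) (c : ℝ) :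
    ∫ y, (laplaceKernel x y * normalDeriv D v y
      - normalDeriv D (fun z => laplaceKernel x z) y * (v y - c)) ∂(surfaceMeasure D) = 0 := by
  have hd0 : d ≠ 0 := by rcases hd with rfl | rfl <;> norm_num
  have hne : ∀ y ∈ closure D, y ≠ x := fun y hy h => hx (h ▸ hy)
  have hGc := (contDiffOn_laplaceKernel hx).continuousOn
  have hVc := hD.continuousOn_gradientOn hv1
  have hWc : ContinuousOn (fun y => laplaceKernelGrad x y) (closure D) := fun y hy =>
    (contDiffAt_laplaceKernelGrad (hne y hy)).continuousAt.continuousWithinAt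
  have hvc : ContinuousOn (fun y => v y - c) (closure D) := hv1.continuousOn.sub continuousOn_const
  have hV : ∀ y ∈ D, ContDiffAt ℝ 1 (gradientOn D v) y := fun y hy => by
    refine ContDiffAt.congr_of_eventuallyEq ?_ (hD.gradientOn_eventuallyEq v hy)
    exact (InnerProductSpace.toDual ℝ (EuclideanSpace ℝ (Fin d))).symm.contDiff.contDiffAt.comp y
      ((hv y hy).1.fderiv_right (m := 1) (by norm_num))
  have key := hD.integral_inner_outwardNormal_eq_zero
    (F := fun y => laplaceKernel x y • gradientOn D v y - (v y - c) • laplaceKernelGrad x y)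
    ((hGc.smul hVc).sub (hvc.smul hWc)) ?_ ?_
  · rw [← key]
    refine integral_congr_ae ((ae_restrict_iff' isClosed_frontier.measurableSet).2
      (.of_forall fun y hy => ?_))
    have hyc := frontier_subset_closure hy
    simp only [inner_sub_left, real_inner_smul_left, inner_gradientOn,
      normalDeriv_laplaceKernel hd hD (hne y hyc) hyc]
    ring
  · intro y hy
    have hyc := subset_closure hy
    have hG : ContDiffAt ℝ 1 (fun y => laplaceKernel x y) y :=
      ((contDiffOn_laplaceKernel hx).mono subset_closure).contDiffAt (hD.isOpen.mem_nhds hy)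
    have hvd : ContDiffAt ℝ 1 (fun y => v y - c) y :=
      ((hv y hy).1.of_le (by norm_num)).sub contDiffAt_const
    exact ((hG.smul (hV y hy)).sub
      (hvd.smul (contDiffAt_laplaceKernelGrad (hne y hyc)))).contDiffWithinAt
  · intro y hy
    have hyc := subset_closure hy
    have hyx := hne y hyc
    have hG := hasFDerivAt_laplaceKernel hd hyx
    have hVd := ((hV y hy).differentiableAt (by norm_num)).hasFDerivAt
    have hWd := ((contDiffAt_laplaceKernelGrad hyx).differentiableAt (by norm_num)).hasFDerivAt
    have hvd : HasFDerivAt (fun y => v y - c) (fderiv ℝ v y) y :=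
      (((hv y hy).1.differentiableAt (by norm_num)).hasFDerivAt).sub_const c
    have h1 := (EuclideanSpace.basisFun (Fin d) ℝ).sum_inner_fderiv_smul hG hVd
    have h2 := (EuclideanSpace.basisFun (Fin d) ℝ).sum_inner_fderiv_smul hvd hWd
    have h3 : fderiv ℝ (fun y => laplaceKernel x y • gradientOn D v y
        - (v y - c) • laplaceKernelGrad x y) y =
        fderiv ℝ (fun y => laplaceKernel x y • gradientOn D v y) y
          - fderiv ℝ (fun y => (v y - c) • laplaceKernelGrad x y) y :=
      fderiv_fun_sub (hG.smul hVd).differentiableAt (hvd.smul hWd).differentiableAt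
    -- By the product rule the divergence is `G Δv - (v - c) ΔG` plus the cross terms `∇G · ∇v - ∇v
    -- · ∇G`; the Laplacians vanish and the cross terms cancel.
    simp only [h3, _root_.sub_apply, inner_sub_right, Finset.sum_sub_distrib, h1, h2]
    rw [sum_inner_fderiv_laplaceKernelGrad hd0 hyx, (hD.gradientOn_eventuallyEq v hy).fderiv_eq,
      (sum_inner_fderiv_gradient (hv y hy).1).2, (hv y hy).2.self_of_nhds,
      (hD.gradientOn_eventuallyEq v hy).self_of_nhds, innerSL_apply_apply, real_inner_comm]
    have h4 : inner ℝ (∇ v y) (laplaceKernelGrad x y) = fderiv ℝ v y (laplaceKernelGrad x y) :=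
      InnerProductSpace.toDual_symm_apply
    rw [h4, Pi.zero_apply]
    ring

end IsC2Domain

/-! ### The modified representation. -/

theorem proposition2 {d : ℕ} (hd : d = 2 ∨ d = 3)
    (D : Set (EuclideanSpace ℝ (Fin d))) (hD : IsC2Domain D)
    -- a function represented in the exterior of `D` by a single layer with continuous density
    (μ u : EuclideanSpace ℝ (Fin d) → ℝ) (hμ : ContinuousOn μ (frontier D))
    (hu : ∀ z ∈ (closure D)ᶜ, u z = singleLayerPotential D μ z)
    -- the evaluation point `x = x* + ℓ n_{x*}` in the exterior of `D`
    (xs : EuclideanSpace ℝ (Fin d)) (hxs : xs ∈ frontier D) (ℓ : ℝ)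
    (x : EuclideanSpace ℝ (Fin d)) (hx : x = xs + ℓ • outwardNormal D xs)
    (hxE : x ∈ (closure D)ᶜ)
    -- a solution of Laplace's equation in `D`, of class `C²(D) ∩ C¹(closure D)`
    (v : EuclideanSpace ℝ (Fin d) → ℝ) (hv : InnerProductSpace.HarmonicOnNhd v D)
    (hv1 : ContDiffOn ℝ 1 v (closure D)) (hvn : normalDeriv D v xs = 1) :
    -- the modified representation, all of whose integrals converge
    (Integrable (fun y => laplaceKernel x y * μ y) (surfaceMeasure D) ∧
      Integrable (integrandOne D μ v x) (surfaceMeasure D) ∧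
      Integrable (integrandTwo D μ v xs x) (surfaceMeasure D) ∧
      Integrable (integrandThree D v xs x) (surfaceMeasure D) ∧
      u x = (∫ y, integrandOne D μ v x y ∂(surfaceMeasure D))
        + (∫ y, integrandTwo D μ v xs x y ∂(surfaceMeasure D))
        + μ xs * ∫ y, integrandThree D v xs x y ∂(surfaceMeasure D)) ∧
    -- its integrands vanish at `y = x*`
    (integrandOne D μ v x xs = 0 ∧ integrandTwo D μ v xs x xs = 0 ∧
      integrandThree D v xs x xs = 0) := by
  have hfc : frontier D ⊆ closure D := frontier_subset_closure
  have hne : ∀ y ∈ closure D, y ≠ x := fun y hy h => hxE (h ▸ hy)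
  have cG : ContinuousOn (fun y => laplaceKernel x y) (frontier D) :=
    (IsC2Domain.contDiffOn_laplaceKernel hxE).continuousOn.mono hfc
  have cN := hD.continuousOn_normalDeriv hv1
  have cN' : ContinuousOn (normalDeriv D fun z => laplaceKernel x z) (frontier D) :=
    hD.continuousOn_normalDeriv (IsC2Domain.contDiffOn_laplaceKernel hxE)
  have cv := hv1.continuousOn.mono hfc
  have i0 : Integrable (fun y => laplaceKernel x y * μ y) (surfaceMeasure D) :=
    hD.integrable_of_continuousOn (cG.mul hμ)
  have i1 : Integrable (integrandOne D μ v x) (surfaceMeasure D) :=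
    hD.integrable_of_continuousOn ((cG.mul hμ).mul (continuousOn_const.sub cN))
  have i2 : Integrable (integrandTwo D μ v xs x) (surfaceMeasure D) :=
    hD.integrable_of_continuousOn ((cG.mul (hμ.sub continuousOn_const)).mul cN)
  have i3 : Integrable (integrandThree D v xs x) (surfaceMeasure D) :=
    hD.integrable_of_continuousOn (cN'.mul (cv.sub continuousOn_const))
  have i4 : Integrable (fun y => laplaceKernel x y * normalDeriv D v y) (surfaceMeasure D) :=
    hD.integrable_of_continuousOn (cG.mul cN)
  refine ⟨⟨i0, i1, i2, i3, ?_⟩, ?_, ?_, ?_⟩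
  · have hgreen := IsC2Domain.integral_green hd hD hxE hv hv1 (v xs)
    have hsub : (∫ y, laplaceKernel x y * normalDeriv D v y ∂(surfaceMeasure D))
        - ∫ y, integrandThree D v xs x y ∂(surfaceMeasure D) = 0 := by
      rw [← integral_sub i4 i3]
      exact hgreen
    -- Pure algebra under the integral sign; only the last summand is changed by Green's identity.
    have hsplit : (∫ y, laplaceKernel x y * μ y ∂(surfaceMeasure D)) =
        (∫ y, integrandOne D μ v x y ∂(surfaceMeasure D))
          + (∫ y, integrandTwo D μ v xs x y ∂(surfaceMeasure D))
          + μ xs * ∫ y, laplaceKernel x y * normalDeriv D v y ∂(surfaceMeasure D) := by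
      have i12 : Integrable (fun y => integrandOne D μ v x y + integrandTwo D μ v xs x y)
          (surfaceMeasure D) := i1.add i2
      rw [← integral_add i1 i2, ← integral_const_mul, ← integral_add i12 (i4.const_mul _)]
      refine integral_congr_ae (.of_forall fun y => ?_)
      simp only [integrandOne, integrandTwo]
      ring
    rw [hu x hxE, singleLayerPotential, hsplit, sub_eq_zero.1 hsub]
  · rw [integrandOne, hvn, sub_self, mul_zero]
  · rw [integrandTwo, sub_self, mul_zero, zero_mul]
  · rw [integrandThree, sub_self, mul_zero]
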